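/- Let $d\ge 2$ and let $P\subset\mathbb R^d$ be a $d$-dimensional polytope (a compact finite intersection of closed half-spaces), with $(d-1)$-dimensional faces $F_1,\dots,F_N$ and interior unit normals $\eta_1,\dots,\eta_N$. Assume that $P$ is spanning: there is $\varepsilon>0$ such that for any $d$ distinct faces the angle between the normal of one of them and the linear span of the other $d-1$ normals is at least $\varepsilon$. Let $f:[0,\frac\pi2)\to[0,\frac\pi2)$ be a contracting reflection law: $f$ is $C^2$, $f(0)=0$ and $0<\sup|f'|<1$. For a unit vector $\eta$ and a unit vector $v$ with $\langle v,\eta\rangle>0$ put $\theta=\arccos\langle v,\eta\rangle$ and $$C_\eta(v)=\frac{\cos f(\theta)}{\cos\theta}\langle v,\eta\rangle\eta+\frac{\sin f(\theta)}{\sin\theta}\bigl(v-\langle v,\eta\rangle\eta\bigr),\qquad C_\eta(\eta)=\eta .$$ Let $M$ be the set of pairs $(p,v)$ with $p$ in the relative interior of some $F_i$, $\|v\|=1$ and $\langle v,\eta_i\rangle>0$; let $M'$ be the set of $(p,v)\in M$ whose half-line $\{p+tv: t\ge0\}$ misses all relative boundaries $\partial F_j$. The contracting billiard map $\Phi:M'\to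 M$ is $\Phi(p,v)=(p+\tau v,\;C_{\eta_j}(v-2\langle v,\eta_j\rangle\eta_j))$, where $\tau>0$ is the first positive time at which $p+\tau v$ lies on a face, and $F_j$ is that face. Let $M^+=\{x\in M:\Phi^n(x)\in M'\ \forall n\ge0\}$ and $D=\bigcap_{n\ge0}\Phi^n(M^+)$. A point $x\in M^+$ is $k$-generating if, for all $0\le i\le j$ with $j-i\ge k$, the normals of the faces containing the base points of $\Phi^i(x),\dots,\Phi^j(x)$ span $\mathbb R^d$. For $x=(p,v)\in M$ with $p\in F_i$, the tangent space is $T_xM=\eta_i^\perp\times v^\perp$. The Jacobi coordinates of $(u,w)\in T_xM$ are $(J,J')=(u-\langle u,v\rangle v,\,w)\in v^\perp\times v^\perp$, the norm on $T_xM$ is $(\|J\|^2+\|J'\|^2)^{1/2}$, and $E^u(x)=\{J'=0\}$. Then there is $\sigma=\sigma(f,P)>1$, depending only on $f$ and $P$, such that for every integer $k\ge d$ and every $k$-generating $x\in D$ the following holds: $\Phi^{2k}$ is differentiable at $x$ along $M$, its derivative restricts to a linear isomorphism $D\Phi^{2k}(x):E^u(x)\to E^u(\Phi^{2k}(x))$,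 and the inverse of this isomorphism satisfies $$\bigl\|D\Phi^{-2k}|_{E^u(\Phi^{2k}(x))}\bigr\|=\bigl\|\bigl(D\Phi^{2k}(x)|_{E^u(x)}\bigr)^{-1}\bigr\|\le \frac1\sigma .$$ -/

import Mathlib

open scoped RealInnerProductSpace

namespace PolytopeBilliard

noncomputable section

/-- The Euclidean space `ℝ^d`. -/
abbrev Euc (d : ℕ) := EuclideanSpace ℝ (Fin d)

/-! ### Polytopes -/

/-- A closed half-space `{x | ⟨x, a⟩ ≤ c}` with `a ≠ 0`. -/
def IsHalfSpace {d : ℕ} (H : Set (Euc d)) : Prop :=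
  ∃ (a : Euc d) (c : ℝ), a ≠ 0 ∧ H = {x | ⟪x, a⟫ ≤ c}

/-- A polyhedron is a finite intersection of half-spaces. -/
def IsPolyhedron {d : ℕ} (P : Set (Euc d)) : Prop :=
  ∃ S : Set (Set (Euc d)), S.Finite ∧ (∀ H ∈ S, IsHalfSpace H) ∧ P = ⋂₀ S

/-- The dimension of the affine subspace spanned by a set. -/
def dimension {d : ℕ} (S : Set (Euc d)) : ℕ :=
  Module.finrank ℝ (vectorSpan ℝ S)

/-- A `d`-dimensional polytope in `ℝ^d`: a compact polyhedron of full dimension. -/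
structure IsFullPolytope {d : ℕ} (P : Set (Euc d)) : Prop where
  polyhedron : IsPolyhedron P
  compact : IsCompact P
  full_dim : dimension P = d

/-- The face of `P` on which the linear form `⟨·, η⟩` attains its minimum over `P`.  It is the
intersection of `P` with the supporting hyperplane of `P` having `η` as inward normal. -/
def face {d : ℕ} (P : Set (Euc d)) (η : Euc d) : Set (Euc d) :=
  {x | x ∈ P ∧ ∀ y ∈ P, ⟪x, η⟫ ≤ ⟪y, η⟫}

/-- The interior unit normals of the `(d-1)`-dimensional faces of `P`.  For a full-dimensional
polytope the `(d-1)`-dimensional faces are the sets `face P η` with `η ∈ normals P`, and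
distinct `η` give distinct faces. -/
def normals {d : ℕ} (P : Set (Euc d)) : Set (Euc d) :=
  {η | ‖η‖ = 1 ∧ dimension (face P η) + 1 = d}

/-- The (relative) interior of a face. -/
def faceInterior {d : ℕ} (P : Set (Euc d)) (η : Euc d) : Set (Euc d) :=
  intrinsicInterior ℝ (face P η)

/-- The `(d-2)`-skeleton: the union of the relative boundaries of the `(d-1)`-faces. -/
def skeleton {d : ℕ} (P : Set (Euc d)) : Set (Euc d) :=
  ⋃ η ∈ normals P, intrinsicFrontier ℝ (face P η)

open Classical in
/-- The interior unit normal at a point in the relative interior of a `(d-1)`-face (`0` at all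
other points). -/
def normalAt {d : ℕ} (P : Set (Euc d)) (p : Euc d) : Euc d :=
  if h : ∃ η ∈ normals P, p ∈ faceInterior P η then h.choose else 0

/-- `P` is `ε`-spanning: for any `d` distinct `(d-1)`-faces, the angle between any one of the
normals and the linear span `E` of the `d - 1` others (the minimum of the angles with the
non-zero vectors of `E`) is at least `ε`. -/
def IsEpsSpanning {d : ℕ} (ε : ℝ) (P : Set (Euc d)) : Prop :=
  ∀ η : Fin d → Euc d, Function.Injective η → (∀ i, η i ∈ normals P) →
    ∀ i, ∀ u ∈ Submodule.span ℝ (η '' {j | j ≠ i}), u ≠ 0 →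
      ε ≤ InnerProductGeometry.angle (η i) u

/-- A spanning polytope. -/
def IsSpanning {d : ℕ} (P : Set (Euc d)) : Prop :=
  ∃ ε : ℝ, 0 < ε ∧ IsEpsSpanning ε P

/-! ### Reflection laws -/

/-- Contracting reflection laws: `C²` maps `f : [0, π/2) → [0, π/2)` with `f 0 = 0` and
`0 < sup |f'| < 1`. -/
structure IsContractingReflectionLaw (f : ℝ → ℝ) : Prop where
  contDiffOn : ContDiffOn ℝ 2 f (Set.Ico 0 (Real.pi / 2))
  mapsTo : Set.MapsTo f (Set.Ico 0 (Real.pi / 2)) (Set.Ico 0 (Real.pi / 2))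
  zero : f 0 = 0
  sup_deriv : ∃ l : ℝ, 0 < l ∧ l < 1 ∧
    IsLUB ((fun θ => |derivWithin f (Set.Ico 0 (Real.pi / 2)) θ|) '' Set.Ico 0 (Real.pi / 2)) l

/-- Orthogonal projection onto the line spanned by the unit vector `η`. -/
def projLine {d : ℕ} (η u : Euc d) : Euc d := ⟪u, η⟫ • η

/-- Orthogonal projection onto the hyperplane orthogonal to the unit vector `η`. -/
def projPerp {d : ℕ} (η u : Euc d) : Euc d := u - projLine η u

/-- Specular reflection about the hyperplane orthogonal to the unit vector `η`. -/
def reflect {d : ℕ} (η u : Euc d) : Euc d := u - (2 * ⟪u, η⟫) • η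

/-- The contracting law `C_η` with reflection law `f`, on the open hemisphere around `η`: a unit
vector at angle `θ` from `η` is moved, in the plane it spans with `η`, to angle `f θ`.
(For `v = η` the last summand vanishes.) -/
def contract {d : ℕ} (f : ℝ → ℝ) (η v : Euc d) : Euc d :=
  let θ := Real.arccos ⟪v, η⟫
  (Real.cos (f θ) / Real.cos θ) • projLine η v + (Real.sin (f θ) / Real.sin θ) • projPerp η v

/-! ### The billiard map -/

/-- The phase space `M`: pairs `(p, v)` of a point in the relative interior of a `(d-1)`-face and
a unit vector pointing strictly inside. -/
def phase {d : ℕ} (P : Set (Euc d)) : Set (Euc d × Euc d) :=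
  {x | ∃ η ∈ normals P, x.1 ∈ faceInterior P η ∧ ‖x.2‖ = 1 ∧ 0 < ⟪x.2, η⟫}

/-- The domain `M'` of the billiard map: the half-line from `p` in direction `v` does not meet the
skeleton. -/
def regular {d : ℕ} (P : Set (Euc d)) : Set (Euc d × Euc d) :=
  {x | x ∈ phase P ∧ ∀ t : ℝ, 0 ≤ t → x.1 + t • x.2 ∉ skeleton P}

/-- The flight time: the first `t > 0` at which `p + t v` lies on a `(d-1)`-face. -/
def flightTime {d : ℕ} (P : Set (Euc d)) (x : Euc d × Euc d) : ℝ :=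
  sInf {t : ℝ | 0 < t ∧ ∃ η ∈ normals P, x.1 + t • x.2 ∈ face P η}

/-- The specular billiard map (meaningful on `regular P`). -/
def specularMap {d : ℕ} (P : Set (Euc d)) (x : Euc d × Euc d) : Euc d × Euc d :=
  let q := x.1 + flightTime P x • x.2
  (q, reflect (normalAt P q) x.2)

/-- The contracting billiard map (meaningful on `regular P`). -/
def billiardMap {d : ℕ} (f : ℝ → ℝ) (P : Set (Euc d)) (x : Euc d × Euc d) : Euc d × Euc d :=
  let y := specularMap P x
  (y.1, contract f (normalAt P y.1) y.2)

/-- `M⁺`: the points of `M` that can be iterated forward for ever. -/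
def forward {d : ℕ} (f : ℝ → ℝ) (P : Set (Euc d)) : Set (Euc d × Euc d) :=
  {x | x ∈ phase P ∧ ∀ n : ℕ, (billiardMap f P)^[n] x ∈ regular P}

/-- The invariant set `D`, the intersection over `n ≥ 0` of the `n`-th images of `M⁺`. -/
def domainD {d : ℕ} (f : ℝ → ℝ) (P : Set (Euc d)) : Set (Euc d × Euc d) :=
  ⋂ n : ℕ, (billiardMap f P)^[n] '' forward f P

/-- `x ∈ M⁺` is `k`-generating: along every orbit segment `x_i, …, x_j` of length `j - i ≥ k` the
face normals span `ℝ^d`. -/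
def IsGenerating {d : ℕ} (f : ℝ → ℝ) (P : Set (Euc d)) (k : ℕ) (x : Euc d × Euc d) : Prop :=
  x ∈ forward f P ∧ ∀ i j : ℕ, i + k ≤ j →
    Submodule.span ℝ ((fun n : ℕ => normalAt P ((billiardMap f P)^[n] x).1) '' Set.Icc i j) = ⊤

/-! ### Tangent spaces, Jacobi coordinates, the unstable direction -/

/-- The tangent space of `M` at `(p, v)`: the product of the hyperplanes orthogonal to the normal
at `p` and to `v`. -/
def tangentM {d : ℕ} (P : Set (Euc d)) (x : Euc d × Euc d) : Submodule ℝ (Euc d × Euc d) :=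
  Submodule.prod (ℝ ∙ normalAt P x.1)ᗮ (ℝ ∙ x.2)ᗮ

/-- Jacobi coordinates `(u, w) ↦ (u - ⟨u, v⟩ v, w)` at `x = (p, v)`. -/
def jacobi {d : ℕ} (x : Euc d × Euc d) : (Euc d × Euc d) →ₗ[ℝ] (Euc d × Euc d) where
  toFun ξ := (projPerp x.2 ξ.1, ξ.2)
  map_add' ξ ζ := by
    simp only [projPerp, projLine, Prod.fst_add, Prod.snd_add, inner_add_left, add_smul,
      Prod.mk_add_mk]
    congr 1
    abel
  map_smul' c ξ := by
    simp [projPerp, projLine, inner_smul_left, smul_sub, mul_smul]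

/-- The Euclidean norm of the Jacobi coordinates of a tangent vector. -/
def jacobiNorm {d : ℕ} (x ξ : Euc d × Euc d) : ℝ :=
  Real.sqrt (‖(jacobi x ξ).1‖ ^ 2 + ‖(jacobi x ξ).2‖ ^ 2)

/-- The (centre-)unstable subspace at `x`: the tangent vectors with Jacobi coordinates
`(J, 0)`. -/
def unstable {d : ℕ} (P : Set (Euc d)) (x : Euc d × Euc d) : Submodule ℝ (Euc d × Euc d) :=
  tangentM P x ⊓ LinearMap.ker (LinearMap.snd ℝ (Euc d) (Euc d) ∘ₗ jacobi x)

/-- The bound `‖DΦ^{-n}|_{E^u}‖ ≤ c` for the block of `n` iterates that starts at `x` and ends at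
`y = Φ^n x`: the map `Φ^n` is differentiable at `x` along `M`, its derivative restricts to a linear
isomorphism from the unstable space at `x` onto the unstable space at `y`, and the inverse of this
isomorphism has norm at most `c` for the norms of the Jacobi coordinates.

The derivative along the submanifold `M` is any linear map `A` with
`Φ^n z = Φ^n x + A (z - x) + o(z - x)` for `z ∈ M`; its values on tangent vectors of `M` are
uniquely determined. -/
def InverseBoundOnUnstable {d : ℕ} (f : ℝ → ℝ) (P : Set (Euc d)) (n : ℕ) (x : Euc d × Euc d)
    (c : ℝ) : Prop :=
  DifferentiableWithinAt ℝ (billiardMap f P)^[n] (phase P) x ∧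
  ∀ A : (Euc d × Euc d) →L[ℝ] (Euc d × Euc d),
    HasFDerivWithinAt (billiardMap f P)^[n] A (phase P) x →
    ∃ L : unstable P x ≃ₗ[ℝ] unstable P ((billiardMap f P)^[n] x),
      (∀ ξ : unstable P x, (L ξ : Euc d × Euc d) = A ξ) ∧
      ∀ ζ : unstable P ((billiardMap f P)^[n] x),
        jacobiNorm x (L.symm ζ) ≤ c * jacobiNorm ((billiardMap f P)^[n] x) ζ

end

end PolytopeBilliard

/-!
For fixed velocity the billiard map moves the base point `p` affinely, and the velocity after a
collision depends only on the velocity before it and on the face.  Hence the unstable vectors at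
`x`, which are the pairs `(u, 0)` with `u` tangent to the face, are mapped to unstable vectors
`(u i, 0)`, where `u (i + 1)` is the projection of `u i` along the velocity `v i` to the hyperplane
of the next face (`hasFDerivWithinAt_iterate_apply`).  Their Jacobi norm squared is the energy
`‖u i‖ ^ 2 - ⟪u i, v i⟫ ^ 2`.  A flight does not change it.  A collision multiplies the part of the
velocity tangent to the face by `sin (f θ) / sin θ ≤ ρ < 1`, so it adds at least
`(1 - ρ ^ 2) * ⟪u (i + 1), v i⟫ ^ 2` to the energy (`IsUnstableOrbit.energy_succ_ge`).

What has to be shown is that these gains add up to a fixed proportion of the initial energy,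
uniformly in `k`.  Suppose that all `⟪u (i + 1), v i⟫` are at most `δ`.  Then each flight but the
first moves `u`
by at most `2 * δ`, and `u n` is orthogonal to the normal of the face met at time `n`.
The claim (`IsUnstableOrbit.abs_inner_le_of_window`) is that `u n` is orthogonal, up to a
constant times `δ`, to the span `E` of all normals met in a time window ending at `n`, with a
constant that depends on `dim E` but not on the length of the window.  This is an induction on
`dim E`.  At the first time `t` at which the normals span `E`, the claim follows from the claim in
a smaller dimension and from a lower bound for the angles between normals and spans of normals.
After `t`, let `F` be the span of the normals met later.  If `F = E`, the window can be shortened.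
Otherwise the claim in a smaller dimension controls `u n` along `F`, while the components of the
velocities orthogonal to `F` are tangent to all the faces met, so that they decay like `ρ ^ j`, and
the total displacement of `u` orthogonal to `F` is at most `2 * δ / (1 - ρ)`.  In a generating
window `E` is the whole space, so `‖u n‖`, and with it the initial energy, is bounded by a constant
times `δ`.

The lower bound for the angles exists because a polytope has finitely many `(d-1)`-faces
(`finite_normals`).  That they cover the boundary follows from an irredundant representation by
half-spaces (`exists_finite_normals_cover`).  Differentiability of the billiard map along the phase
space is clear except at perpendicular collisions, where `arccos` is not differentiable and
`f` is defined on one side only; there it holds along the unit sphere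
(`differentiableWithinAt_contract_self`).
-/

namespace PolytopeBilliard

/-! ### Growth of the linearised dynamics -/

section linearised

variable {V : Type*} [NormedAddCommGroup V] [InnerProductSpace ℝ V]

/-- The angle between a vector and a subspace that does not contain it is positive. -/
theorem exists_gap_of_notMem [FiniteDimensional ℝ V] {E : Submodule ℝ V} {η : V} (h : η ∉ E) :
    ∃ κ : ℝ, 0 < κ ∧ ∀ e ∈ E, ∀ c : ℝ, κ * |c| ≤ ‖e + c • η‖ := by
  have hne : (E : Set V).Nonempty := ⟨0, E.zero_mem⟩
  have hcl : IsClosed (E : Set V) := E.closed_of_finiteDimensional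
  refine ⟨Metric.infDist η E, (hcl.notMem_iff_infDist_pos hne).1 h, fun e he c => ?_⟩
  rcases eq_or_ne c 0 with rfl | hc
  · simp
  have h1 : Metric.infDist η (E : Set V) ≤ dist η ((-c⁻¹) • e) :=
    Metric.infDist_le_dist_of_mem (E.smul_mem _ he)
  have h2 : e + c • η = c • (η - (-c⁻¹) • e) := by
    rw [smul_sub, smul_smul]
    simp [hc, add_comm]
  rw [h2, norm_smul, Real.norm_eq_abs, ← dist_eq_norm, mul_comm]
  gcongr

/-- Finitely many vectors span only finitely many subspaces, so the angles between the vectors and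
the subspaces that do not contain them are bounded below. -/
theorem exists_uniform_gap [FiniteDimensional ℝ V] {S : Set V} (hS : S.Finite) :
    ∃ κ : ℝ, 0 < κ ∧ ∀ A ⊆ S, ∀ η ∈ S, η ∉ Submodule.span ℝ A →
      ∀ e ∈ Submodule.span ℝ A, ∀ c : ℝ, κ * |c| ≤ ‖e + c • η‖ := by
  have key : ∀ x : Set V × V, ∃ κ : ℝ, 0 < κ ∧ (x.2 ∉ Submodule.span ℝ x.1 →
      ∀ e ∈ Submodule.span ℝ x.1, ∀ c : ℝ, κ * |c| ≤ ‖e + c • x.2‖) := by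
    intro x
    by_cases h : x.2 ∈ Submodule.span ℝ x.1
    · exact ⟨1, one_pos, fun h' => absurd h h'⟩
    · obtain ⟨κ, h0, h1⟩ := exists_gap_of_notMem h
      exact ⟨κ, h0, fun _ => h1⟩
  choose κ hκ0 hκ using key
  have hfin : (S.powerset ×ˢ S).Finite := hS.finite_subsets.prod hS
  have : ∃ κ₀ : ℝ, 0 < κ₀ ∧ ∀ x ∈ S.powerset ×ˢ S, κ₀ ≤ κ x := by
    rcases (S.powerset ×ˢ S).eq_empty_or_nonempty with h | h
    · exact ⟨1, one_pos, by simp [h]⟩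
    · obtain ⟨x₀, -, h0⟩ := Set.exists_min_image _ κ hfin h
      exact ⟨κ x₀, hκ0 _, h0⟩
  obtain ⟨κ₀, h0, h1⟩ := this
  refine ⟨κ₀, h0, fun A hA η hη hn e he c => ?_⟩
  have h2 : κ₀ ≤ κ (A, η) := h1 (A, η) ⟨hA, hη⟩
  exact (mul_le_mul_of_nonneg_right h2 (abs_nonneg c)).trans (hκ (A, η) hn e he c)

/-- The linearised dynamics on the unstable spaces: `v i` are the velocities, `η i` the normals
and `u i` the base-point components of the images of an unstable vector.  During a flight `u`
changes by a multiple of the velocity, and at a collision the part of the velocity tangent to the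
face is multiplied by a factor `c i ∈ [0, ρ]`. -/
structure IsUnstableOrbit (ρ : ℝ) (η v u : ℕ → V) (c s : ℕ → ℝ) : Prop where
  norm_v : ∀ i, ‖v i‖ = 1
  u_normal : ∀ i, ⟪u i, η i⟫ = 0
  u_succ : ∀ i, u (i + 1) = u i + s i • v i
  c_nonneg : ∀ i, 0 ≤ c i
  c_le : ∀ i, c i ≤ ρ
  v_succ : ∀ i e, ⟪e, η (i + 1)⟫ = 0 → ⟪e, v (i + 1)⟫ = c i * ⟪e, v i⟫

namespace IsUnstableOrbit

variable {ρ : ℝ} {η v u : ℕ → V} {c s : ℕ → ℝ}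

/-- The squared norm of the component of `u i` orthogonal to `v i`. -/
def energy (v u : ℕ → V) (i : ℕ) : ℝ := ‖u i‖ ^ 2 - ⟪u i, v i⟫ ^ 2

theorem inner_succ (h : IsUnstableOrbit ρ η v u c s) (i : ℕ) :
    ⟪u (i + 1), v (i + 1)⟫ = c i * ⟪u (i + 1), v i⟫ :=
  h.v_succ i _ (h.u_normal (i + 1))

theorem step_eq (h : IsUnstableOrbit ρ η v u c s) (i : ℕ) :
    s i = ⟪u (i + 1), v i⟫ - ⟪u i, v i⟫ := by
  rw [h.u_succ, inner_add_left, inner_smul_left, real_inner_self_eq_norm_sq, h.norm_v]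
  simp

/-- Only collisions change the energy, and they increase it. -/
theorem energy_succ (h : IsUnstableOrbit ρ η v u c s) (i : ℕ) :
    energy v u (i + 1) = energy v u i + (1 - c i ^ 2) * ⟪u (i + 1), v i⟫ ^ 2 := by
  have h1 : ‖u (i + 1)‖ ^ 2 - ⟪u (i + 1), v i⟫ ^ 2 = energy v u i := by
    have h2 : ‖u i + s i • v i‖ ^ 2 = ‖u i‖ ^ 2 + 2 * (s i * ⟪u i, v i⟫) + s i ^ 2 := by
      rw [norm_add_sq_real, inner_smul_right, norm_smul, h.norm_v, mul_one, Real.norm_eq_abs,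
        sq_abs]
    have h3 := h.step_eq i
    have h4 : ⟪u (i + 1), v i⟫ = ⟪u i, v i⟫ + s i := by linarith
    rw [h4, h.u_succ, h2, energy]
    ring
  rw [← h1, energy, h.inner_succ]
  ring

theorem energy_succ_ge (h : IsUnstableOrbit ρ η v u c s) (i : ℕ) :
    energy v u i + (1 - ρ ^ 2) * ⟪u (i + 1), v i⟫ ^ 2 ≤ energy v u (i + 1) := by
  rw [h.energy_succ]
  have := pow_le_pow_left₀ (h.c_nonneg i) (h.c_le i) 2
  gcongr

theorem energy_mono (h : IsUnstableOrbit ρ η v u c s) (hρ : ρ < 1) : Monotone (energy v u) := by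
  refine monotone_nat_of_le_succ fun i => le_trans ?_ (h.energy_succ_ge i)
  have h0 : 0 ≤ ρ := (h.c_nonneg 0).trans (h.c_le 0)
  have : 0 ≤ (1 - ρ ^ 2) * ⟪u (i + 1), v i⟫ ^ 2 := mul_nonneg (by nlinarith) (sq_nonneg _)
  linarith

/-- Over a stretch of collisions with faces whose normals are orthogonal to `e`, the pairings
`⟪e, v j⟫` decay geometrically, so `⟪u, e⟫` changes by a bounded amount however long the stretch
is. -/
theorem abs_inner_sub_le (h : IsUnstableOrbit ρ η v u c s) (hρ : ρ < 1) {δ : ℝ} (hδ : 0 ≤ δ) {t : ℕ}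
    {e : V} (n : ℕ) (hs : ∀ i, t ≤ i → i < t + n → |s i| ≤ δ)
    (he : ∀ i, t < i → i ≤ t + n → ⟪e, η i⟫ = 0) :
    |⟪u (t + n) - u t, e⟫| ≤ δ / (1 - ρ) * ‖e‖ := by
  have h0 : 0 ≤ ρ := (h.c_nonneg 0).trans (h.c_le 0)
  have hv : ∀ j, j ≤ n → |⟪e, v (t + j)⟫| ≤ ρ ^ j * ‖e‖ := by
    intro j
    induction j with
    | zero =>
      intro _
      simpa [h.norm_v] using abs_real_inner_le_norm e (v t)
    | succ j ih =>
      intro hj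
      rw [← add_assoc, h.v_succ (t + j) e (he _ (by omega) (by omega)), abs_mul,
        abs_of_nonneg (h.c_nonneg _), pow_succ', mul_assoc]
      exact mul_le_mul (h.c_le _) (ih (by omega)) (abs_nonneg _) h0
  have hu : ∀ j, j ≤ n → |⟪u (t + j) - u t, e⟫| ≤ δ * ((1 - ρ ^ j) / (1 - ρ)) * ‖e‖ := by
    intro j
    induction j with
    | zero => intro _; simp
    | succ j ih =>
      intro hj
      have h1 : u (t + (j + 1)) - u t = (u (t + j) - u t) + s (t + j) • v (t + j) := by
        rw [← add_assoc, h.u_succ]; abel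
      rw [h1, inner_add_left, real_inner_smul_left, real_inner_comm e (v (t + j))]
      have h2 : |s (t + j) * ⟪e, v (t + j)⟫| ≤ δ * (ρ ^ j * ‖e‖) := by
        rw [abs_mul]
        have := hs (t + j) (by omega) (by omega)
        exact mul_le_mul this (hv j (by omega)) (abs_nonneg _) ((abs_nonneg _).trans this)
      have h3 : (1 - ρ ^ (j + 1)) / (1 - ρ) = (1 - ρ ^ j) / (1 - ρ) + ρ ^ j := by
        have : 1 - ρ ≠ 0 := by linarith
        field_simp
        ring
      have h4 := ih (by omega)
      rw [h3]
      refine (abs_add_le _ _).trans ?_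
      linarith
  refine (hu n le_rfl).trans ?_
  rw [div_eq_mul_inv, div_eq_mul_inv]
  have : 0 < (1 - ρ)⁻¹ := inv_pos.2 (by linarith)
  have := pow_nonneg h0 n
  gcongr
  nlinarith

/-- The constants in the induction on the dimension of the span of the normals; `κ` bounds the
angles between normals and spans of normals from below. -/
noncomputable def spanConst (κ ρ : ℝ) : ℕ → ℝ
  | 0 => 1
  | r + 1 => spanConst κ ρ r + 2 / (1 - ρ) + (spanConst κ ρ r + 2) * (1 + 1 / κ)

theorem spanConst_pos {κ ρ : ℝ} (hκ : 0 < κ) (hρ : ρ < 1) (r : ℕ) : 0 < spanConst κ ρ r := by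
  have : 0 < 1 - ρ := by linarith
  induction r with
  | zero => exact one_pos
  | succ r ih => rw [spanConst]; positivity

/-- A vector orthogonal to `n` which is almost orthogonal to a subspace `E` is almost orthogonal
to the span of `E` and `n`, with a loss controlled by the angle between `n` and `E`. -/
theorem abs_inner_le_of_gap {E : Submodule ℝ V} {n w : V} {κ B : ℝ} (hκ : 0 < κ) (hB : 0 ≤ B)
    (hn : ‖n‖ = 1) (hgap : ∀ e ∈ E, ∀ c : ℝ, κ * |c| ≤ ‖e + c • n‖) (hw : ⟪w, n⟫ = 0)
    (hE : ∀ e ∈ E, |⟪w, e⟫| ≤ B * ‖e‖) :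
    ∀ e ∈ E ⊔ Submodule.span ℝ {n}, |⟪w, e⟫| ≤ B * (1 + 1 / κ) * ‖e‖ := by
  intro e he
  obtain ⟨e', he', y, hy, rfl⟩ := Submodule.mem_sup.1 he
  obtain ⟨c, rfl⟩ := Submodule.mem_span_singleton.1 hy
  have h1 : ⟪w, e' + c • n⟫ = ⟪w, e'⟫ := by
    rw [inner_add_right, real_inner_smul_right, hw, mul_zero, add_zero]
  rw [h1]
  refine (hE e' he').trans ?_
  rw [mul_assoc]
  refine mul_le_mul_of_nonneg_left ?_ hB
  have h2 : ‖e'‖ ≤ ‖e' + c • n‖ + |c| := by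
    calc ‖e'‖ = ‖(e' + c • n) - c • n‖ := by rw [add_sub_cancel_right]
      _ ≤ ‖e' + c • n‖ + ‖c • n‖ := norm_sub_le _ _
      _ = _ := by rw [norm_smul, hn, mul_one, Real.norm_eq_abs]
  have h3 : |c| ≤ 1 / κ * ‖e' + c • n‖ := by
    rw [one_div, ← div_eq_inv_mul, le_div_iff₀ hκ, mul_comm]
    exact hgap e' he' c
  linarith

theorem energy_le_norm_sq (v u : ℕ → V) (i : ℕ) : energy v u i ≤ ‖u i‖ ^ 2 := by
  rw [energy]
  linarith [sq_nonneg ⟪u i, v i⟫]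

variable [FiniteDimensional ℝ V]

/-- If the pairings `⟪u (i + 1), v i⟫` are at most `δ`, then `u n` is almost orthogonal to the
span of the normals met in a time window ending at `n`, with a constant that depends on the
dimension of the span but not on the length of the window. -/
theorem abs_inner_le_of_window (h : IsUnstableOrbit ρ η v u c s) (hρ : ρ < 1) {κ δ : ℝ}
    (hκ : 0 < κ) (hδ : 0 ≤ δ) (hη : ∀ i, ‖η i‖ = 1)
    (hgap : ∀ (A : Set ℕ) (n : ℕ), η n ∉ Submodule.span ℝ (η '' A) →
      ∀ e ∈ Submodule.span ℝ (η '' A), ∀ x : ℝ, κ * |x| ≤ ‖e + x • η n‖)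
    {K : ℕ} (ha : ∀ i, i < K → |⟪u (i + 1), v i⟫| ≤ δ) (r : ℕ) :
    ∀ m n : ℕ, 1 ≤ m → n ≤ K → Module.finrank ℝ (Submodule.span ℝ (η '' Set.Icc m n)) ≤ r →
      ∀ e ∈ Submodule.span ℝ (η '' Set.Icc m n), |⟪u n, e⟫| ≤ spanConst κ ρ r * δ * ‖e‖ := by
  have hs : ∀ i, 1 ≤ i → i < K → |s i| ≤ 2 * δ := by
    intro i hi hiK
    obtain ⟨j, rfl⟩ : ∃ j, i = j + 1 := ⟨i - 1, by omega⟩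
    have h1 := ha (j + 1) hiK
    have h2 := ha j (by omega)
    have h3 : |⟪u (j + 1), v (j + 1)⟫| ≤ δ := by
      rw [h.inner_succ, abs_mul, abs_of_nonneg (h.c_nonneg j)]
      have := mul_le_mul ((h.c_le j).trans hρ.le) h2 (abs_nonneg _) zero_le_one
      linarith
    rw [h.step_eq]
    exact (abs_sub _ _).trans (by linarith)
  induction r with
  | zero =>
    intro m n _ _ hr e he
    have h0 : Submodule.span ℝ (η '' Set.Icc m n) = ⊥ :=
      Submodule.finrank_eq_zero.1 (Nat.le_zero.1 hr)
    rw [h0, Submodule.mem_bot] at he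
    simp [he]
  | succ r ihr =>
    intro m n hm hn
    -- inner induction on the length of the window
    induction hl : n - m using Nat.strong_induction_on generalizing m with
    | _ l ihl =>
    intro hr e he
    set E := Submodule.span ℝ (η '' Set.Icc m n) with hE
    have hC := spanConst_pos hκ hρ r
    have hρ' : 0 < 1 - ρ := by linarith
    rcases lt_or_ge n m with hnm | hmn
    · rw [hE, Set.Icc_eq_empty (by omega), Set.image_empty, Submodule.span_empty,
        Submodule.mem_bot] at he
      simp [he]
    -- `t` is the first time at which the normals met since time `m` span `E`
    obtain ⟨t, hmt, htn, htE, htE'⟩ : ∃ t, m ≤ t ∧ t ≤ n ∧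
        E ≤ Submodule.span ℝ (η '' Set.Ico m t) ⊔ Submodule.span ℝ {η t} ∧
        ¬ E ≤ Submodule.span ℝ (η '' Set.Ico m t) := by
      classical
      have hex : ∃ T, E ≤ Submodule.span ℝ (η '' Set.Ico m T) :=
        ⟨n + 1, Submodule.span_mono (Set.image_mono fun i hi => ⟨hi.1, Nat.lt_succ_of_le hi.2⟩)⟩
      have hT := Nat.find_spec hex
      have hTn : Nat.find hex ≤ n + 1 := Nat.find_min' hex
        (Submodule.span_mono (Set.image_mono fun i hi => ⟨hi.1, Nat.lt_succ_of_le hi.2⟩))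
      have hmT : m < Nat.find hex := by
        by_contra hlt
        rw [Set.Ico_eq_empty (by omega), Set.image_empty, Submodule.span_empty] at hT
        have h1 : η m ∈ E := Submodule.subset_span ⟨m, ⟨le_rfl, hmn⟩, rfl⟩
        have h2 : η m = 0 := by simpa using hT h1
        simpa [h2] using hη m
      obtain ⟨t, ht⟩ : ∃ t, Nat.find hex = t + 1 := ⟨Nat.find hex - 1, by omega⟩
      refine ⟨t, by omega, by omega, ?_, Nat.find_min hex (by omega)⟩
      rw [ht, ← Set.insert_Ico_right_eq_Ico_add_one (by omega), Set.image_insert_eq,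
        Submodule.span_insert, sup_comm] at hT
      exact hT
    have hsub : Submodule.span ℝ (η '' Set.Ico m t) ≤ E :=
      Submodule.span_mono (Set.image_mono fun i hi => ⟨hi.1, hi.2.le.trans htn⟩)
    have hlt : Submodule.span ℝ (η '' Set.Ico m t) < E := lt_of_le_not_ge hsub htE'
    have hnot : η t ∉ Submodule.span ℝ (η '' Set.Ico m t) := fun hmem =>
      htE' (htE.trans (sup_le le_rfl ((Submodule.span_singleton_le_iff_mem _ _).2 hmem)))
    -- at time `t` the vector `u` is almost orthogonal to `E`
    have hut : ∀ e ∈ E, |⟪u t, e⟫| ≤ (spanConst κ ρ r + 2) * δ * (1 + 1 / κ) * ‖e‖ := by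
      intro e he
      refine abs_inner_le_of_gap hκ (by positivity) (hη t) (hgap _ t hnot) (h.u_normal t) ?_ e
        (htE he)
      intro e he
      rcases hmt.eq_or_lt with rfl | hmt'
      · rw [Set.Ico_self, Set.image_empty, Submodule.span_empty, Submodule.mem_bot] at he
        simp [he]
      obtain ⟨j, rfl⟩ : ∃ j, t = j + 1 := ⟨t - 1, by omega⟩
      have h1 : Set.Ico m (j + 1) = Set.Icc m j := by ext i; simp
      rw [h1] at he hlt
      have h2 := ihr m j hm (by omega)
        (Nat.lt_succ_iff.1 ((Submodule.finrank_lt_finrank_of_lt hlt).trans_le hr)) e he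
      rw [h.u_succ, inner_add_left, real_inner_smul_left]
      have h3 : |s j * ⟪v j, e⟫| ≤ 2 * δ * ‖e‖ := by
        rw [abs_mul]
        refine mul_le_mul (hs j (by omega) (by omega)) ?_ (abs_nonneg _) (by positivity)
        simpa [h.norm_v] using abs_real_inner_le_norm (v j) e
      refine (abs_add_le _ _).trans ?_
      linarith
    -- the normals met after time `t`
    set F := Submodule.span ℝ (η '' Set.Icc (t + 1) n) with hF
    have hFE : F ≤ E :=
      Submodule.span_mono (Set.image_mono fun i hi => ⟨by have := hi.1; omega, hi.2⟩)
    rcases hFE.eq_or_lt with hFE' | hFE'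
    · have htn' : t ≠ n := by
        rintro rfl
        rw [Set.Icc_eq_empty (by omega), Set.image_empty, Submodule.span_empty] at hF
        exact not_lt_bot ((hF ▸ hFE') ▸ hlt)
      refine ihl (n - (t + 1)) (by omega) (t + 1) (by omega) rfl ?_ e ?_
      · rw [← hF, hFE']; exact hr
      · rw [← hF, hFE']; exact he
    · have hFr : Module.finrank ℝ F ≤ r :=
        Nat.lt_succ_iff.1 ((Submodule.finrank_lt_finrank_of_lt hFE').trans_le hr)
      -- split `e` along `F` and its orthogonal complement
      set e₁ : V := F.starProjection e with he₁
      have he₁F : e₁ ∈ F := Submodule.starProjection_apply_mem _ _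
      have he₂F : e - e₁ ∈ Fᗮ := Submodule.sub_starProjection_mem_orthogonal _
      have hn₁ : ‖e₁‖ ≤ ‖e‖ := F.norm_starProjection_apply_le e
      have hn₂ : ‖e - e₁‖ ≤ ‖e‖ := by
        have h1 : ‖e‖ ^ 2 = ‖e₁‖ ^ 2 + ‖e - e₁‖ ^ 2 := by
          have h2 : ⟪e₁, e - e₁⟫ = 0 := he₂F e₁ he₁F
          have h3 := norm_add_sq_real e₁ (e - e₁)
          rw [add_sub_cancel, h2] at h3
          linarith
        refine (sq_le_sq₀ (norm_nonneg _) (norm_nonneg _)).1 ?_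
        linarith [sq_nonneg ‖e₁‖]
      have b₁ := ihr (t + 1) n (by omega) hn hFr e₁ he₁F
      have b₂ := hut (e - e₁) (E.sub_mem he (hFE he₁F))
      obtain ⟨l', rfl⟩ : ∃ l', n = t + l' := ⟨n - t, by omega⟩
      have b₃ := h.abs_inner_sub_le hρ (δ := 2 * δ) (by positivity) (t := t) (e := e - e₁) l'
        (fun i hi hi' => hs i (by omega) (by omega))
        (fun i hi hi' => by
          rw [real_inner_comm]
          exact he₂F _ (Submodule.subset_span ⟨i, ⟨hi, hi'⟩, rfl⟩))
      have hsplit : ⟪u (t + l'), e⟫ =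
          ⟪u (t + l'), e₁⟫ + ⟪u (t + l') - u t, e - e₁⟫ + ⟪u t, e - e₁⟫ := by
        simp only [inner_sub_left, inner_sub_right]; ring
      rw [hsplit, spanConst]
      have c₁ : spanConst κ ρ r * δ * ‖e₁‖ ≤ spanConst κ ρ r * δ * ‖e‖ := by gcongr
      have c₂ : (spanConst κ ρ r + 2) * δ * (1 + 1 / κ) * ‖e - e₁‖ ≤
          (spanConst κ ρ r + 2) * δ * (1 + 1 / κ) * ‖e‖ := by gcongr
      have c₃ : 2 * δ / (1 - ρ) * ‖e - e₁‖ ≤ 2 * δ / (1 - ρ) * ‖e‖ := by gcongr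
      refine ((abs_add_le _ _).trans (add_le_add_left (abs_add_le _ _) _)).trans ?_
      calc _ ≤ spanConst κ ρ r * δ * ‖e‖ + 2 * δ / (1 - ρ) * ‖e‖ +
            (spanConst κ ρ r + 2) * δ * (1 + 1 / κ) * ‖e‖ := by linarith
        _ = _ := by ring

/-- Uniform growth of the energy as soon as the normals met at the times `1, …, K` span the
space. -/
theorem energy_growth (h : IsUnstableOrbit ρ η v u c s) (hρ : ρ < 1) {κ : ℝ}
    (hκ : 0 < κ) (hη : ∀ i, ‖η i‖ = 1)
    (hgap : ∀ (A : Set ℕ) (n : ℕ), η n ∉ Submodule.span ℝ (η '' A) →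
      ∀ e ∈ Submodule.span ℝ (η '' A), ∀ x : ℝ, κ * |x| ≤ ‖e + x • η n‖)
    {K : ℕ} (hspan : Submodule.span ℝ (η '' Set.Icc 1 K) = ⊤) :
    (1 + (1 - ρ ^ 2) / spanConst κ ρ (Module.finrank ℝ V) ^ 2) * energy v u 0 ≤ energy v u K := by
  have h0 : 0 ≤ ρ := (h.c_nonneg 0).trans (h.c_le 0)
  have hρ2 : 0 < 1 - ρ ^ 2 := by nlinarith
  have hmono := h.energy_mono hρ
  set C := spanConst κ ρ (Module.finrank ℝ V) with hCdef
  have hC : 0 < C := spanConst_pos hκ hρ _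
  set δ : ℝ := √((energy v u K - energy v u 0) / (1 - ρ ^ 2)) with hδ
  have hnn : 0 ≤ (energy v u K - energy v u 0) / (1 - ρ ^ 2) :=
    div_nonneg (sub_nonneg.2 (hmono (Nat.zero_le K))) hρ2.le
  have hδ2 : δ ^ 2 * (1 - ρ ^ 2) = energy v u K - energy v u 0 := by
    rw [hδ, Real.sq_sqrt hnn, div_mul_cancel₀ _ hρ2.ne']
  have ha : ∀ i, i < K → |⟪u (i + 1), v i⟫| ≤ δ := by
    intro i hi
    refine Real.le_sqrt_of_sq_le ?_
    rw [sq_abs, le_div_iff₀ hρ2]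
    have h1 := h.energy_succ_ge i
    have h2 := hmono (Nat.zero_le i)
    have h3 := hmono (Nat.succ_le_of_lt hi)
    simp only [Nat.succ_eq_add_one] at h3
    linarith
  have h1 := h.abs_inner_le_of_window hρ hκ (Real.sqrt_nonneg _) hη hgap ha (Module.finrank ℝ V)
    1 K le_rfl le_rfl (Submodule.finrank_le _) (u K) (by rw [hspan]; trivial)
  rw [← hCdef, real_inner_self_eq_norm_sq, abs_of_nonneg (sq_nonneg _)] at h1
  have h2 : ‖u K‖ ≤ C * δ := by
    rcases (norm_nonneg (u K)).eq_or_lt with h3 | h3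
    · rw [← h3]; exact mul_nonneg hC.le (Real.sqrt_nonneg _)
    · rw [sq] at h1
      exact le_of_mul_le_mul_right h1 h3
  have h3 : energy v u 0 ≤ C ^ 2 * δ ^ 2 := by
    calc energy v u 0 ≤ energy v u K := hmono (Nat.zero_le K)
      _ ≤ ‖u K‖ ^ 2 := energy_le_norm_sq v u K
      _ ≤ (C * δ) ^ 2 := pow_le_pow_left₀ (norm_nonneg _) h2 2
      _ = _ := mul_pow _ _ _
  have h4 : (1 - ρ ^ 2) / C ^ 2 * energy v u 0 ≤ energy v u K - energy v u 0 := by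
    rw [← hδ2, div_mul_eq_mul_div, div_le_iff₀ (by positivity)]
    nlinarith
  linarith

end IsUnstableOrbit

end linearised

/-! ### Faces of a polytope -/

section faces

variable {d : ℕ} {P : Set (Euc d)} {η : Euc d}

theorem inner_eq_of_mem_face {x y : Euc d} (hx : x ∈ face P η) (hy : y ∈ face P η) :
    ⟪x, η⟫ = ⟪y, η⟫ :=
  le_antisymm (hx.2 y hy.1) (hy.2 x hx.1)

theorem convex_face (hP : Convex ℝ P) (η : Euc d) : Convex ℝ (face P η) := by
  intro x hx y hy a b ha hb hab
  refine ⟨hP hx.1 hy.1 ha hb hab, fun z hz => ?_⟩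
  rw [inner_add_left, real_inner_smul_left, real_inner_smul_left]
  have h1 := mul_le_mul_of_nonneg_left (hx.2 z hz) ha
  have h2 := mul_le_mul_of_nonneg_left (hy.2 z hz) hb
  calc _ ≤ a * ⟪z, η⟫ + b * ⟪z, η⟫ := add_le_add h1 h2
    _ = _ := by rw [← add_mul, hab, one_mul]

namespace IsFullPolytope

theorem convex (hP : IsFullPolytope P) : Convex ℝ P := by
  obtain ⟨S, -, hS, rfl⟩ := hP.polyhedron
  refine convex_sInter fun H hH => ?_
  obtain ⟨a, c, -, rfl⟩ := hS H hH
  simp_rw [real_inner_comm a]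
  exact convex_halfSpace_le (innerₛₗ ℝ a).isLinear c

theorem isClosed (hP : IsFullPolytope P) : IsClosed P := hP.compact.isClosed

theorem interior_nonempty (hP : IsFullPolytope P) (hd : 2 ≤ d) : (interior P).Nonempty := by
  have h1 : vectorSpan ℝ P = ⊤ := by
    apply Submodule.eq_top_of_finrank_eq
    have := hP.full_dim
    rw [dimension] at this
    rw [this, finrank_euclideanSpace_fin]
  have hne : P.Nonempty := by
    rw [Set.nonempty_iff_ne_empty]
    rintro rfl
    have := hP.full_dim
    rw [dimension, vectorSpan_empty, finrank_bot] at this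
    omega
  rw [hP.convex.interior_nonempty_iff_affineSpan_eq_top]
  exact (AffineSubspace.affineSpan_eq_top_iff_vectorSpan_eq_top_of_nonempty ℝ _ _ hne).2 h1

end IsFullPolytope

theorem inner_lt_of_mem_interior {x z : Euc d} (hη : η ≠ 0) (hx : x ∈ face P η)
    (hz : z ∈ interior P) : ⟪x, η⟫ < ⟪z, η⟫ := by
  have h1 : ∀ᶠ t : ℝ in nhdsWithin 0 (Set.Ioi 0), z - t • η ∈ P := by
    have : Filter.Tendsto (fun t : ℝ => z - t • η) (nhds 0) (nhds z) := by
      have : Continuous fun t : ℝ => z - t • η := by fun_prop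
      simpa using this.tendsto 0
    exact (this.mono_left nhdsWithin_le_nhds).eventually (mem_interior_iff_mem_nhds.1 hz)
  obtain ⟨t, ht, ht0⟩ := (h1.and self_mem_nhdsWithin).exists
  have h2 := hx.2 _ ht
  rw [inner_sub_left, real_inner_smul_left, real_inner_self_eq_norm_sq] at h2
  have : 0 < t * ‖η‖ ^ 2 := mul_pos ht0 (by positivity)
  linarith

theorem notMem_interior_of_mem_face {x : Euc d} (hη : η ≠ 0) (hx : x ∈ face P η) :
    x ∉ interior P := fun h => lt_irrefl _ (inner_lt_of_mem_interior hη hx h)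

theorem ne_zero_of_mem_normals (h : η ∈ normals P) : η ≠ 0 := by
  rintro rfl
  simpa using h.1

theorem vectorSpan_face_le (P : Set (Euc d)) (η : Euc d) :
    vectorSpan ℝ (face P η) ≤ (ℝ ∙ η)ᗮ := by
  rw [vectorSpan_def, Submodule.span_le]
  rintro _ ⟨x, hx, y, hy, rfl⟩
  change x - y ∈ (ℝ ∙ η)ᗮ
  rw [Submodule.mem_orthogonal_singleton_iff_inner_left, inner_sub_left,
    inner_eq_of_mem_face hx hy, sub_self]

theorem finrank_orthogonal_add_one {a : Euc d} (ha : a ≠ 0) :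
    Module.finrank ℝ (ℝ ∙ a)ᗮ + 1 = d := by
  have h := (ℝ ∙ a).finrank_add_finrank_orthogonal
  rw [finrank_span_singleton ha, finrank_euclideanSpace_fin] at h
  omega

theorem vectorSpan_face (h : η ∈ normals P) : vectorSpan ℝ (face P η) = (ℝ ∙ η)ᗮ := by
  refine Submodule.eq_of_le_of_finrank_eq (vectorSpan_face_le P η) ?_
  have h1 := finrank_orthogonal_add_one (ne_zero_of_mem_normals h)
  have h2 := h.2
  rw [dimension] at h2
  omega

/-- The relative interior of a `(d-1)`-face, described by discs of its hyperplane. -/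
theorem mem_faceInterior_iff (h : η ∈ normals P) {p : Euc d} :
    p ∈ faceInterior P η ↔ p ∈ face P η ∧
      ∃ r > 0, ∀ y, dist y p < r → ⟪y, η⟫ = ⟪p, η⟫ → y ∈ face P η := by
  have key : ∀ p ∈ face P η, ∀ y, y ∈ affineSpan ℝ (face P η) ↔ ⟪y, η⟫ = ⟪p, η⟫ := by
    intro p hp y
    rw [← AffineSubspace.vsub_right_mem_direction_iff_mem (mem_affineSpan ℝ hp),
      direction_affineSpan, vectorSpan_face h, Submodule.mem_orthogonal_singleton_iff_inner_left,
      vsub_eq_sub, inner_sub_left, sub_eq_zero]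
  constructor
  · intro hp
    have hpF : p ∈ face P η := intrinsicInterior_subset hp
    refine ⟨hpF, ?_⟩
    obtain ⟨y, hy, rfl⟩ := mem_intrinsicInterior.1 hp
    obtain ⟨r, hr, hball⟩ := Metric.mem_nhds_iff.1 (mem_interior_iff_mem_nhds.1 hy)
    refine ⟨r, hr, fun z hz hzi => ?_⟩
    exact @hball ⟨z, (key _ hpF z).2 hzi⟩ (by simpa [Subtype.dist_eq] using hz)
  · rintro ⟨hpF, r, hr, hball⟩
    refine mem_intrinsicInterior.2 ⟨⟨p, mem_affineSpan ℝ hpF⟩, ?_, rfl⟩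
    refine mem_interior_iff_mem_nhds.2 (Metric.mem_nhds_iff.2 ⟨r, hr, ?_⟩)
    intro z hz
    exact hball z (by simpa [Subtype.dist_eq] using hz) ((key _ hpF z).1 z.2)

theorem faceInterior_subset {p : Euc d} (hp : p ∈ faceInterior P η) : p ∈ face P η :=
  intrinsicInterior_subset hp

/-- Near a point in the relative interior of a `(d-1)`-face, the polytope is a half-space. -/
theorem exists_half_ball (hd : 2 ≤ d) (hP : IsFullPolytope P) (hη : η ∈ normals P) {p : Euc d}
    (hp : p ∈ faceInterior P η) :
    ∃ r > 0, ∀ y, dist y p < r → ⟪p, η⟫ ≤ ⟪y, η⟫ → y ∈ P := by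
  obtain ⟨hpF, r, hr, hball⟩ := (mem_faceInterior_iff hη).1 hp
  obtain ⟨z, hz⟩ := hP.interior_nonempty hd
  have hpz := inner_lt_of_mem_interior (ne_zero_of_mem_normals hη) hpF hz
  -- every `y` near `p` is `(1 - s y) • w y + s y • z` with `w y` on the hyperplane of the face
  set s : Euc d → ℝ := fun y => (⟪y, η⟫ - ⟪p, η⟫) / (⟪z, η⟫ - ⟪p, η⟫) with hs
  set w : Euc d → Euc d := fun y => (1 - s y)⁻¹ • (y - s y • z) with hw
  have hs0 : s p = 0 := by simp [hs]
  have hwp : w p = p := by simp [hw, hs0]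
  have hsc : Continuous s := by fun_prop
  have hwc : ContinuousAt w p := by
    have h0 : ContinuousAt (fun y => 1 - s y) p := by fun_prop
    have h1 : ContinuousAt (fun y => y - s y • z) p := by fun_prop
    exact (h0.inv₀ (by simp [hs0])).smul h1
  have h1 : ∀ᶠ y in nhds p, dist (w y) p < r := by
    have := hwc.eventually (Metric.ball_mem_nhds (w p) hr)
    rw [hwp] at this
    exact this
  have h2 : ∀ᶠ y in nhds p, s y < 1 :=
    hsc.continuousAt.eventually (gt_mem_nhds (by rw [hs0]; exact one_pos))
  obtain ⟨r', hr', hb⟩ := Metric.eventually_nhds_iff.1 (h1.and h2)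
  refine ⟨r', hr', fun y hy hyi => ?_⟩
  obtain ⟨hy1, hy2⟩ := hb hy
  have hsy : 0 ≤ s y := div_nonneg (by linarith) (by linarith)
  have hne : 1 - s y ≠ 0 := by linarith
  have hsy' : s y * (⟪z, η⟫ - ⟪p, η⟫) = ⟪y, η⟫ - ⟪p, η⟫ :=
    div_mul_cancel₀ _ (by linarith)
  have hwi : ⟪w y, η⟫ = ⟪p, η⟫ := by
    simp only [hw, real_inner_smul_left, inner_sub_left]
    rw [inv_mul_eq_iff_eq_mul₀ hne]
    linarith
  have hyw : y = (1 - s y) • w y + s y • z := by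
    simp only [hw]
    rw [smul_inv_smul₀ hne, sub_add_cancel]
  rw [hyw]
  exact hP.convex (hball _ hy1 hwi).1 (interior_subset hz) (by linarith) hsy (by ring)

/-- The relative interior of a `(d-1)`-face does not meet any other face. -/
theorem eq_of_mem_faceInterior (hd : 2 ≤ d) (hP : IsFullPolytope P) (hη : η ∈ normals P)
    {p η' : Euc d} (hp : p ∈ faceInterior P η) (hη' : ‖η'‖ = 1) (hp' : p ∈ face P η') :
    η' = η := by
  obtain ⟨r, hr, hball⟩ := exists_half_ball hd hP hη hp
  have key : ∀ h : Euc d, 0 ≤ ⟪h, η⟫ → 0 ≤ ⟪h, η'⟫ := by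
    intro h hh
    have : ∀ᶠ t : ℝ in nhdsWithin 0 (Set.Ioi 0), dist (p + t • h) p < r := by
      have h1 : Continuous fun t : ℝ => dist (p + t • h) p := by fun_prop
      have h2 := h1.continuousAt (x := 0)
      exact nhdsWithin_le_nhds (h2.eventually (gt_mem_nhds (by simpa using hr)))
    obtain ⟨t, ht, ht0⟩ := (this.and self_mem_nhdsWithin).exists
    have ht0 : 0 < t := ht0
    have h3 := hball _ ht (by
      rw [inner_add_left, real_inner_smul_left]
      have := mul_nonneg ht0.le hh
      linarith)
    have h4 := hp'.2 _ h3
    rw [inner_add_left, real_inner_smul_left] at h4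
    exact nonneg_of_mul_nonneg_right (by linarith : 0 ≤ t * ⟪h, η'⟫) ht0
  have hn : ‖η‖ = 1 := hη.1
  have h1 : 0 ≤ ⟪η, η'⟫ := key η (by rw [real_inner_self_eq_norm_sq, hn]; norm_num)
  have h2 := key (⟪η', η⟫ • η - η') (by
    rw [inner_sub_left, real_inner_smul_left, real_inner_self_eq_norm_sq, hn]; simp)
  rw [inner_sub_left, real_inner_smul_left, real_inner_self_eq_norm_sq, hη',
    real_inner_comm] at h2
  have h3 : ⟪η, η'⟫ ≤ 1 := by
    simpa [hn, hη'] using real_inner_le_norm η η'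
  have h4 : ⟪η, η'⟫ = 1 := by nlinarith
  exact ((inner_eq_one_iff_of_norm_eq_one hn hη').1 h4).symm

theorem normalAt_eq (hd : 2 ≤ d) (hP : IsFullPolytope P) (hη : η ∈ normals P) {p : Euc d}
    (hp : p ∈ faceInterior P η) : normalAt P p = η := by
  have h : ∃ η ∈ normals P, p ∈ faceInterior P η := ⟨η, hη, hp⟩
  rw [normalAt, dif_pos h]
  obtain ⟨h1, h2⟩ := h.choose_spec
  exact eq_of_mem_faceInterior hd hP hη hp h1.1 (faceInterior_subset h2)

/-- The `(d-1)`-faces cover the boundary of a polytope, and finitely many of them suffice. -/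
theorem exists_finite_normals_cover (hd : 2 ≤ d) (hP : IsFullPolytope P) :
    ∃ T : Set (Euc d), T.Finite ∧ T ⊆ normals P ∧
      ∀ x ∈ P, x ∉ interior P → ∃ η ∈ T, x ∈ face P η := by
  classical
  obtain ⟨z, hz⟩ := hP.interior_nonempty hd
  obtain ⟨S, hSf, hS, hPS⟩ := hP.polyhedron
  -- an irredundant family of half-spaces
  obtain ⟨S, hS, hPS, hmin⟩ : ∃ S : Finset (Set (Euc d)),
      (∀ H ∈ S, IsHalfSpace H) ∧ P = ⋂₀ (S : Set (Set (Euc d))) ∧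
      ∀ H ∈ S, P ≠ ⋂₀ ((S.erase H : Finset _) : Set (Set (Euc d))) := by
    have hex : ∃ n : ℕ, ∃ S : Finset (Set (Euc d)), S.card = n ∧
        (∀ H ∈ S, IsHalfSpace H) ∧ P = ⋂₀ (S : Set (Set (Euc d))) :=
      ⟨_, hSf.toFinset, rfl, by simpa using hS, by simpa using hPS⟩
    obtain ⟨S, hSc, hSh, hSP⟩ := Nat.find_spec hex
    refine ⟨S, hSh, hSP, fun H hH he => ?_⟩
    refine Nat.find_min hex (m := (S.erase H).card) ?_
      ⟨S.erase H, rfl, fun H' hH' => hSh _ (Finset.mem_of_mem_erase hH'), he⟩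
    rw [← hSc]
    exact Finset.card_erase_lt_of_mem hH
  choose! a c ha hH using hS
  have hmem : ∀ x, x ∈ P ↔ ∀ H ∈ S, ⟪x, a H⟫ ≤ c H := by
    intro x
    rw [hPS, Set.mem_sInter]
    refine forall₂_congr fun H hHS => ?_
    conv_lhs => rw [hH H hHS]
    rfl
  have hzlt : ∀ H ∈ S, ⟪z, a H⟫ < c H := by
    intro H hHS
    have h1 : ∀ᶠ t : ℝ in nhdsWithin 0 (Set.Ioi 0), z + t • a H ∈ P := by
      have : Filter.Tendsto (fun t : ℝ => z + t • a H) (nhds 0) (nhds z) := by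
        have : Continuous fun t : ℝ => z + t • a H := by fun_prop
        simpa using this.tendsto 0
      exact (this.mono_left nhdsWithin_le_nhds).eventually (mem_interior_iff_mem_nhds.1 hz)
    obtain ⟨t, ht, ht0⟩ := (h1.and self_mem_nhdsWithin).exists
    have h2 := (hmem _).1 ht H hHS
    rw [inner_add_left, real_inner_smul_left, real_inner_self_eq_norm_sq] at h2
    have := ha H hHS
    have : 0 < t * ‖a H‖ ^ 2 := mul_pos ht0 (by positivity)
    linarith
  set ν : Set (Euc d) → Euc d := fun H => -(‖a H‖⁻¹ • a H) with hν
  have hνi : ∀ H x, ⟪x, ν H⟫ = -(‖a H‖⁻¹ * ⟪x, a H⟫) := by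
    intro H x
    simp only [hν, inner_neg_right, real_inner_smul_right]
  have hface : ∀ H ∈ S, ∀ x ∈ P, ⟪x, a H⟫ = c H → x ∈ face P (ν H) := by
    intro H hHS x hx hxc
    refine ⟨hx, fun y hy => ?_⟩
    rw [hνi, hνi, hxc]
    have := (hmem y).1 hy H hHS
    gcongr
  refine ⟨ν '' S, S.finite_toSet.image _, ?_, ?_⟩
  · rintro _ ⟨H, hHS, rfl⟩
    have hHS : H ∈ S := hHS
    have ha0 := ha H hHS
    have hνn : ‖ν H‖ = 1 := by
      simp only [hν, norm_neg, norm_smul, norm_inv, norm_norm]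
      exact inv_mul_cancel₀ (norm_ne_zero_iff.2 ha0)
    have hν0 : ν H ≠ 0 := by
      intro h
      rw [h, norm_zero] at hνn
      exact zero_ne_one hνn
    refine ⟨hνn, ?_⟩
    -- a point that violates the inequality of `H` only
    obtain ⟨y, hy, hyH⟩ : ∃ y, (∀ H' ∈ S, H' ≠ H → ⟪y, a H'⟫ ≤ c H') ∧ c H < ⟪y, a H⟫ := by
      by_contra! hcon
      refine hmin H hHS (Set.Subset.antisymm ?_ ?_)
      · rw [hPS]
        exact Set.sInter_subset_sInter (by exact_mod_cast Finset.erase_subset H S)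
      · intro y hy
        rw [Set.mem_sInter] at hy
        have h1 : ∀ H' ∈ S, H' ≠ H → ⟪y, a H'⟫ ≤ c H' := by
          intro H' hH' hne
          have h2 : y ∈ H' := hy H' (Finset.mem_coe.2 (Finset.mem_erase.2 ⟨hne, hH'⟩))
          rw [hH H' hH'] at h2
          exact h2
        refine (hmem y).2 fun H' hH' => ?_
        rcases eq_or_ne H' H with rfl | hne
        · exact hcon y h1
        · exact h1 H' hH' hne
    -- the segment from `z` to `y` meets the hyperplane of `H` in the interior of the face
    have hzH := hzlt H hHS
    set t : ℝ := (c H - ⟪z, a H⟫) / (⟪y, a H⟫ - ⟪z, a H⟫) with ht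
    have hden : 0 < ⟪y, a H⟫ - ⟪z, a H⟫ := by linarith
    have ht0 : 0 ≤ t := div_nonneg (by linarith) hden.le
    have ht1 : t < 1 := by rw [ht, div_lt_one hden]; linarith
    have htm : t * (⟪y, a H⟫ - ⟪z, a H⟫) = c H - ⟪z, a H⟫ := div_mul_cancel₀ _ hden.ne'
    set q : Euc d := (1 - t) • z + t • y with hq
    have hqi : ∀ b, ⟪q, b⟫ = (1 - t) * ⟪z, b⟫ + t * ⟪y, b⟫ := by
      intro b
      simp only [hq, inner_add_left, real_inner_smul_left]
    have hqH : ⟪q, a H⟫ = c H := by rw [hqi]; linarith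
    have hqlt : ∀ H' ∈ S, H' ≠ H → ⟪q, a H'⟫ < c H' := by
      intro H' hH' hne
      rw [hqi]
      have h1 := mul_lt_mul_of_pos_left (hzlt H' hH') (by linarith : 0 < 1 - t)
      have h2 := mul_le_mul_of_nonneg_left (hy H' hH' hne) ht0
      linarith
    have hnear : ∀ᶠ x in nhds q, ∀ H' ∈ S, H' ≠ H → ⟪x, a H'⟫ < c H' := by
      rw [Filter.eventually_all_finset]
      intro H' hH'
      rcases eq_or_ne H' H with rfl | hne
      · exact Filter.Eventually.of_forall fun x h => absurd rfl h
      · have h1 : Continuous fun x : Euc d => ⟪x, a H'⟫ := by fun_prop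
        filter_upwards [h1.continuousAt.eventually (gt_mem_nhds (hqlt H' hH' hne))] with x hx _
        exact hx
    have hnear' : ∀ᶠ x in nhds q, ⟪x, a H⟫ = c H → x ∈ face P (ν H) := by
      filter_upwards [hnear] with x hx hxH
      refine hface H hHS x ((hmem x).2 fun H' hH' => ?_) hxH
      rcases eq_or_ne H' H with rfl | hne
      · exact hxH.le
      · exact (hx H' hH' hne).le
    have hqF : q ∈ face P (ν H) := hnear'.self_of_nhds hqH
    have hspan : (ℝ ∙ ν H)ᗮ ≤ vectorSpan ℝ (face P (ν H)) := by
      intro h hh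
      rw [Submodule.mem_orthogonal_singleton_iff_inner_left, hνi, neg_eq_zero, mul_eq_zero] at hh
      have hh' : ⟪h, a H⟫ = 0 := hh.resolve_left (inv_ne_zero (norm_ne_zero_iff.2 ha0))
      have h1 : Filter.Tendsto (fun t : ℝ => q + t • h) (nhds 0) (nhds q) := by
        have : Continuous fun t : ℝ => q + t • h := by fun_prop
        simpa using this.tendsto 0
      have h2 := (h1.mono_left (nhdsWithin_le_nhds (s := Set.Ioi 0))).eventually hnear'
      obtain ⟨t, ht, ht0⟩ := (h2.and self_mem_nhdsWithin).exists
      have ht0 : 0 < t := ht0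
      have h3 := ht (by rw [inner_add_left, real_inner_smul_left, hh', mul_zero, add_zero, hqH])
      have h4 := vsub_mem_vectorSpan ℝ h3 hqF
      rw [vsub_eq_sub, add_sub_cancel_left] at h4
      exact (Submodule.smul_mem_iff _ ht0.ne').1 h4
    rw [dimension, le_antisymm (vectorSpan_face_le P (ν H)) hspan]
    exact finrank_orthogonal_add_one hν0
  · intro x hx hxi
    by_contra! hcon
    refine hxi (mem_interior_iff_mem_nhds.2 ?_)
    have hlt : ∀ H ∈ S, ⟪x, a H⟫ < c H := by
      intro H hHS
      refine lt_of_le_of_ne ((hmem x).1 hx H hHS) fun he => ?_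
      exact hcon (ν H) ⟨H, hHS, rfl⟩ (hface H hHS x hx he)
    have hnear : ∀ᶠ y in nhds x, ∀ H ∈ S, ⟪y, a H⟫ < c H := by
      rw [Filter.eventually_all_finset]
      intro H hHS
      have h1 : Continuous fun y : Euc d => ⟪y, a H⟫ := by fun_prop
      exact h1.continuousAt.eventually (gt_mem_nhds (hlt H hHS))
    filter_upwards [hnear] with y hy
    exact (hmem y).2 fun H hHS => (hy H hHS).le

/-- A normal is determined by any relative interior point of its face, so the finite family of
faces that covers the boundary contains all `(d-1)`-faces. -/
theorem finite_normals (hd : 2 ≤ d) (hP : IsFullPolytope P) : (normals P).Finite := by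
  obtain ⟨T, hT, hTn, hcov⟩ := exists_finite_normals_cover hd hP
  refine hT.subset fun η hη => ?_
  have hne : (face P η).Nonempty := by
    rw [Set.nonempty_iff_ne_empty]
    intro h
    have h2 := hη.2
    rw [h, dimension, vectorSpan_empty, finrank_bot] at h2
    omega
  obtain ⟨p, hp⟩ := hne.intrinsicInterior (convex_face hP.convex η)
  have hpF := faceInterior_subset hp
  obtain ⟨η', hη', hp'⟩ := hcov p hpF.1
    (notMem_interior_of_mem_face (ne_zero_of_mem_normals hη) hpF)
  rwa [← eq_of_mem_faceInterior hd hP hη hp (hTn hη').1 hp']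

/-! ### The flight -/

section flight

variable {x : Euc d × Euc d}

theorem exists_pos_forall_mem_interior (hd : 2 ≤ d) (hP : IsFullPolytope P) (hx : x ∈ phase P) :
    ∃ ε : ℝ, 0 < ε ∧ ∀ t : ℝ, 0 < t → t < ε → x.1 + t • x.2 ∈ interior P := by
  obtain ⟨η, hη, hp, -, hv⟩ := hx
  obtain ⟨r, hr, hball⟩ := exists_half_ball hd hP hη hp
  have h1 : ∀ᶠ t : ℝ in nhds 0, dist (x.1 + t • x.2) x.1 < r := by
    have h1 : Continuous fun t : ℝ => dist (x.1 + t • x.2) x.1 := by fun_prop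
    exact h1.continuousAt.eventually (gt_mem_nhds (by simpa using hr))
  obtain ⟨ε, hε, hb⟩ := Metric.eventually_nhds_iff.1 h1
  refine ⟨ε, hε, fun t ht0 ht => mem_interior.2
    ⟨{y | dist y x.1 < r} ∩ {y | ⟪x.1, η⟫ < ⟪y, η⟫}, fun y hy => hball y hy.1 hy.2.le, ?_, ?_⟩⟩
  · exact (isOpen_lt (by fun_prop) (by fun_prop)).inter (isOpen_lt (by fun_prop) (by fun_prop))
  · refine ⟨hb (by simpa [abs_of_pos ht0] using ht), ?_⟩
    have := mul_pos ht0 hv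
    change ⟪x.1, η⟫ < ⟪x.1 + t • x.2, η⟫
    rw [inner_add_left, real_inner_smul_left]
    linarith

theorem mem_interior_of_lt (hd : 2 ≤ d) (hP : IsFullPolytope P) (hx : x ∈ phase P) {s t : ℝ}
    (hs : 0 < s) (hst : s < t) (ht : x.1 + t • x.2 ∈ P) : x.1 + s • x.2 ∈ interior P := by
  obtain ⟨ε, hε, h⟩ := exists_pos_forall_mem_interior hd hP hx
  set r := min (ε / 2) (s / 2) with hr
  have hr0 : 0 < r := by positivity
  have hrε : r < ε := (min_le_left _ _).trans_lt (by linarith)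
  have hrs : r < s := (min_le_right _ _).trans_lt (by linarith)
  refine hP.convex.openSegment_interior_self_subset_interior (h r hr0 hrε) ht ?_
  have htr : 0 < t - r := by linarith
  refine ⟨(t - s) / (t - r), (s - r) / (t - r), div_pos (by linarith) htr,
    div_pos (by linarith) htr, by field_simp; ring, ?_⟩
  have h1 : (t - s) / (t - r) + (s - r) / (t - r) = 1 := by field_simp; ring
  have h2 : (t - s) / (t - r) * r + (s - r) / (t - r) * t = s := by field_simp; ring
  calc _ = ((t - s) / (t - r) + (s - r) / (t - r)) • x.1 +
        ((t - s) / (t - r) * r + (s - r) / (t - r) * t) • x.2 := by module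
    _ = _ := by rw [h1, h2, one_smul]

/-- A trajectory meets the boundary only once, so the first point on a face is the only one. -/
theorem flightTime_eq (hd : 2 ≤ d) (hP : IsFullPolytope P) (hx : x ∈ phase P)
    (hη : η ∈ normals P) {t : ℝ} (ht : 0 < t) (hq : x.1 + t • x.2 ∈ face P η) :
    flightTime P x = t := by
  have : {t : ℝ | 0 < t ∧ ∃ η ∈ normals P, x.1 + t • x.2 ∈ face P η} = {t} := by
    refine Set.eq_singleton_iff_unique_mem.2 ⟨⟨ht, η, hη, hq⟩, ?_⟩
    rintro s ⟨hs, η', hη', hq'⟩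
    rcases lt_trichotomy s t with h | h | h
    · exact absurd (mem_interior_of_lt hd hP hx hs h hq.1)
        (notMem_interior_of_mem_face (ne_zero_of_mem_normals hη') hq')
    · exact h
    · exact absurd (mem_interior_of_lt hd hP hx ht h hq'.1)
        (notMem_interior_of_mem_face (ne_zero_of_mem_normals hη) hq)
  rw [flightTime, this, csInf_singleton]

theorem inner_neg_of_mem_face (hd : 2 ≤ d) (hP : IsFullPolytope P) (hx : x ∈ phase P)
    (hη : η ∈ normals P) {t : ℝ} (ht : 0 < t) (hq : x.1 + t • x.2 ∈ face P η) :
    ⟪x.2, η⟫ < 0 := by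
  have h1 := inner_lt_of_mem_interior (ne_zero_of_mem_normals hη) hq
    (mem_interior_of_lt hd hP hx (half_pos ht) (half_lt_self ht) hq.1)
  simp only [inner_add_left, real_inner_smul_left] at h1
  by_contra! hcon
  have := mul_nonneg ht.le hcon
  linarith

theorem exists_mem_face (hd : 2 ≤ d) (hP : IsFullPolytope P) (hx : x ∈ phase P) :
    ∃ t : ℝ, 0 < t ∧ ∃ η ∈ normals P, x.1 + t • x.2 ∈ face P η := by
  obtain ⟨T, -, hTn, hcov⟩ := exists_finite_normals_cover hd hP
  obtain ⟨ε, hε, hint⟩ := exists_pos_forall_mem_interior hd hP hx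
  obtain ⟨-, -, -, hv, -⟩ := hx
  set K : Set ℝ := {t | x.1 + t • x.2 ∈ P} with hK
  have hKc : IsClosed K := hP.isClosed.preimage (by fun_prop)
  have hKb : Bornology.IsBounded K := by
    obtain ⟨R, hR⟩ := hP.compact.isBounded.exists_norm_le
    refine (Metric.isBounded_closedBall (x := (0 : ℝ)) (r := R + ‖x.1‖)).subset fun t ht => ?_
    have h1 : t • x.2 = (x.1 + t • x.2) - x.1 := by abel
    have h2 : ‖t • x.2‖ ≤ R + ‖x.1‖ := by
      rw [h1]
      exact (norm_sub_le _ _).trans (add_le_add_left (hR _ ht) _)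
    rw [norm_smul, hv, mul_one] at h2
    simpa using h2
  have hKne : x.1 + (ε / 2) • x.2 ∈ P := interior_subset (hint _ (half_pos hε) (half_lt_self hε))
  obtain ⟨t, htK, htmax⟩ := (Metric.isCompact_of_isClosed_isBounded hKc hKb).exists_isGreatest
    ⟨ε / 2, hKne⟩
  have ht0 : 0 < t := (half_pos hε).trans_le (htmax hKne)
  obtain ⟨η, hη, hq⟩ := hcov _ htK fun hti => by
    have h1 : ∀ᶠ s in nhdsWithin t (Set.Ioi t), s ∈ K := by
      have h2 : Continuous fun s : ℝ => x.1 + s • x.2 := by fun_prop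
      exact nhdsWithin_le_nhds (h2.continuousAt.eventually (mem_interior_iff_mem_nhds.1 hti))
    obtain ⟨s, hs, hts⟩ := (h1.and self_mem_nhdsWithin).exists
    exact absurd (htmax hs) (not_le.2 hts)
  exact ⟨t, ht0, η, hTn hη, hq⟩

/-- A regular trajectory hits the relative interior of a `(d-1)`-face, from inside. -/
theorem exists_collision (hd : 2 ≤ d) (hP : IsFullPolytope P) (hx : x ∈ regular P) :
    0 < flightTime P x ∧ ∃ η ∈ normals P, x.1 + flightTime P x • x.2 ∈ faceInterior P η ∧
      ⟪x.2, η⟫ < 0 := by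
  obtain ⟨t, ht, η, hη, hq⟩ := exists_mem_face hd hP hx.1
  rw [flightTime_eq hd hP hx.1 hη ht hq]
  refine ⟨ht, η, hη, ?_, inner_neg_of_mem_face hd hP hx.1 hη ht hq⟩
  have h1 : x.1 + t • x.2 ∉ intrinsicFrontier ℝ (face P η) := fun h =>
    hx.2 t ht.le (Set.mem_iUnion₂.2 ⟨η, hη, h⟩)
  have h2 : x.1 + t • x.2 ∈ intrinsicClosure ℝ (face P η) := subset_intrinsicClosure hq
  rw [← intrinsicInterior_union_intrinsicFrontier] at h2
  exact h2.resolve_right h1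

end flight

end faces

/-! ### Reflection laws -/

section laws

variable {d : ℕ} {f : ℝ → ℝ} {η v w : Euc d}

/-- The factor by which the law `C_η` multiplies the component of `w` orthogonal to `η`. -/
noncomputable def contractFactor (f : ℝ → ℝ) (η w : Euc d) : ℝ :=
  Real.sin (f (Real.arccos ⟪w, η⟫)) / Real.sin (Real.arccos ⟪w, η⟫)

namespace IsContractingReflectionLaw

theorem exists_le_mul (hf : IsContractingReflectionLaw f) :
    ∃ l : ℝ, 0 < l ∧ l < 1 ∧ ∀ θ ∈ Set.Ico 0 (Real.pi / 2), f θ ≤ l * θ := by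
  obtain ⟨l, hl0, hl1, hl⟩ := hf.sup_deriv
  refine ⟨l, hl0, hl1, fun θ hθ => ?_⟩
  have h1 := Convex.norm_image_sub_le_of_norm_derivWithin_le (𝕜 := ℝ) (f := f) (C := l)
    (s := Set.Ico 0 (Real.pi / 2)) (x := 0) (y := θ)
    (hf.contDiffOn.differentiableOn (by norm_num))
    (fun x hx => hl.1 ⟨x, hx, rfl⟩) (convex_Ico _ _) ⟨le_rfl, by positivity⟩ hθ
  rw [hf.zero, sub_zero, sub_zero, Real.norm_eq_abs, Real.norm_eq_abs, abs_of_nonneg hθ.1] at h1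
  exact (le_abs_self _).trans h1

/-- The ratio `sin (f θ) / sin θ` is bounded away from `1`, also as `θ` tends to `0` or `π / 2`. -/
theorem exists_sin_le (hf : IsContractingReflectionLaw f) :
    ∃ ρ : ℝ, ρ < 1 ∧ ∀ θ ∈ Set.Ico 0 (Real.pi / 2), Real.sin (f θ) ≤ ρ * Real.sin θ := by
  obtain ⟨l, hl0, hl1, hl⟩ := hf.exists_le_mul
  have hπ := Real.pi_pos
  set c : ℝ := Real.cos ((1 + l) * (Real.pi / 4)) with hc
  have hc0 : 0 < c := Real.cos_pos_of_mem_Ioo ⟨by nlinarith, by nlinarith⟩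
  have hm : 0 < 2 / Real.pi * (1 - l) * c := by
    have : 0 < 1 - l := by linarith
    positivity
  refine ⟨1 - 2 / Real.pi * (1 - l) * c, by linarith, fun θ hθ => ?_⟩
  have hfθ := hf.mapsTo hθ
  have h0 := hθ.1
  have h0' := hθ.2
  have hlθ : l * θ ≤ θ := by nlinarith
  have h1 : Real.sin (f θ) ≤ Real.sin (l * θ) :=
    Real.sin_le_sin_of_le_of_le_pi_div_two (by linarith [hfθ.1]) (by linarith) (hl θ hθ)
  have h2 : Real.sin θ - Real.sin (l * θ) =
      2 * Real.sin ((1 - l) * θ / 2) * Real.cos ((1 + l) * θ / 2) := by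
    rw [Real.sin_sub_sin]
    ring_nf
  have h3 : 2 / Real.pi * ((1 - l) * θ / 2) ≤ Real.sin ((1 - l) * θ / 2) :=
    Real.mul_le_sin (by nlinarith) (by nlinarith)
  have h4 : c ≤ Real.cos ((1 + l) * θ / 2) :=
    Real.cos_le_cos_of_nonneg_of_le_pi (by positivity) (by nlinarith) (by nlinarith)
  have h5 : Real.sin θ ≤ θ := Real.sin_le h0
  have h6 : 0 ≤ 2 / Real.pi * ((1 - l) * θ / 2) := by
    have : 0 ≤ 1 - l := by linarith
    positivity
  have h7 : 2 / Real.pi * ((1 - l) * θ / 2) * c ≤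
      Real.sin ((1 - l) * θ / 2) * Real.cos ((1 + l) * θ / 2) :=
    mul_le_mul h3 h4 hc0.le (h6.trans h3)
  have h8 : 2 / Real.pi * (1 - l) * c * Real.sin θ ≤ 2 / Real.pi * (1 - l) * c * θ :=
    mul_le_mul_of_nonneg_left h5 hm.le
  linarith

end IsContractingReflectionLaw

theorem norm_projPerp_sq (hη : ‖η‖ = 1) (w : Euc d) :
    ‖projPerp η w‖ ^ 2 = ‖w‖ ^ 2 - ⟪w, η⟫ ^ 2 := by
  rw [projPerp, projLine, norm_sub_sq_real, real_inner_smul_right, norm_smul, hη, mul_one,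
    Real.norm_eq_abs, sq_abs]
  ring

theorem inner_projPerp (hη : ‖η‖ = 1) (w : Euc d) : ⟪projPerp η w, η⟫ = 0 := by
  rw [projPerp, projLine, inner_sub_left, real_inner_smul_left, real_inner_self_eq_norm_sq, hη]
  ring

theorem norm_reflect (hη : ‖η‖ = 1) (v : Euc d) : ‖reflect η v‖ = ‖v‖ := by
  have h : ‖reflect η v‖ ^ 2 = ‖v‖ ^ 2 := by
    rw [reflect, norm_sub_sq_real, real_inner_smul_right, norm_smul, hη, mul_one,
      Real.norm_eq_abs, sq_abs]
    ring
  exact (sq_eq_sq₀ (norm_nonneg _) (norm_nonneg _)).1 h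

theorem inner_reflect (hη : ‖η‖ = 1) (v : Euc d) : ⟪reflect η v, η⟫ = -⟪v, η⟫ := by
  rw [reflect, inner_sub_left, real_inner_smul_left, real_inner_self_eq_norm_sq, hη]
  ring

theorem inner_le_one (hη : ‖η‖ = 1) (hw : ‖w‖ = 1) : ⟪w, η⟫ ≤ 1 := by
  simpa [hη, hw] using real_inner_le_norm w η

theorem arccos_inner_mem (h : 0 < ⟪w, η⟫) :
    Real.arccos ⟪w, η⟫ ∈ Set.Ico 0 (Real.pi / 2) :=
  ⟨Real.arccos_nonneg _, Real.arccos_lt_pi_div_two.2 h⟩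

theorem cos_arccos_inner (hη : ‖η‖ = 1) (hw : ‖w‖ = 1) (h : 0 < ⟪w, η⟫) :
    Real.cos (Real.arccos ⟪w, η⟫) = ⟪w, η⟫ :=
  Real.cos_arccos (by linarith) (inner_le_one hη hw)

theorem sin_arccos_inner (hη : ‖η‖ = 1) (hw : ‖w‖ = 1) :
    Real.sin (Real.arccos ⟪w, η⟫) = ‖projPerp η w‖ := by
  rw [Real.sin_arccos, ← Real.sqrt_sq (norm_nonneg (projPerp η w)), norm_projPerp_sq hη, hw,
    one_pow]

theorem contract_eq (hη : ‖η‖ = 1) (hw : ‖w‖ = 1) (h : 0 < ⟪w, η⟫) :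
    contract f η w =
      Real.cos (f (Real.arccos ⟪w, η⟫)) • η + contractFactor f η w • projPerp η w := by
  simp only [contract, contractFactor]
  rw [cos_arccos_inner hη hw h, projLine, smul_smul, div_mul_cancel₀ _ h.ne']

theorem contractFactor_nonneg (hf : IsContractingReflectionLaw f) (h : 0 < ⟪w, η⟫) :
    0 ≤ contractFactor f η w := by
  have h1 := hf.mapsTo (arccos_inner_mem h)
  have hπ := Real.pi_pos
  exact div_nonneg (Real.sin_nonneg_of_nonneg_of_le_pi h1.1 (by linarith [h1.2]))
    (Real.sin_nonneg_of_nonneg_of_le_pi (Real.arccos_nonneg _) (Real.arccos_le_pi _))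

theorem contractFactor_le {ρ : ℝ} (hρ0 : 0 ≤ ρ)
    (hρ : ∀ θ ∈ Set.Ico 0 (Real.pi / 2), Real.sin (f θ) ≤ ρ * Real.sin θ) (h : 0 < ⟪w, η⟫) :
    contractFactor f η w ≤ ρ :=
  div_le_of_le_mul₀ (Real.sin_nonneg_of_nonneg_of_le_pi (Real.arccos_nonneg _)
    (Real.arccos_le_pi _)) hρ0 (hρ _ (arccos_inner_mem h))

theorem inner_contract (hη : ‖η‖ = 1) (hw : ‖w‖ = 1) (h : 0 < ⟪w, η⟫) :
    ⟪contract f η w, η⟫ = Real.cos (f (Real.arccos ⟪w, η⟫)) := by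
  rw [contract_eq hη hw h, inner_add_left, real_inner_smul_left, real_inner_smul_left,
    inner_projPerp hη, real_inner_self_eq_norm_sq, hη]
  ring

theorem inner_contract_pos (hf : IsContractingReflectionLaw f) (hη : ‖η‖ = 1) (hw : ‖w‖ = 1)
    (h : 0 < ⟪w, η⟫) : 0 < ⟪contract f η w, η⟫ := by
  rw [inner_contract hη hw h]
  have h1 := hf.mapsTo (arccos_inner_mem h)
  exact Real.cos_pos_of_mem_Ioo ⟨by linarith [h1.1, Real.pi_pos], h1.2⟩

theorem norm_contract (hf : IsContractingReflectionLaw f) (hη : ‖η‖ = 1) (hw : ‖w‖ = 1)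
    (h : 0 < ⟪w, η⟫) : ‖contract f η w‖ = 1 := by
  have h1 : contractFactor f η w * ‖projPerp η w‖ = Real.sin (f (Real.arccos ⟪w, η⟫)) := by
    rw [contractFactor, sin_arccos_inner hη hw]
    -- at a perpendicular collision both sides vanish, because `f 0 = 0`
    refine div_mul_cancel_of_imp fun h0 => ?_
    rw [← sin_arccos_inner hη hw] at h0
    have h2 : Real.arccos ⟪w, η⟫ = 0 := by
      by_contra hne
      have h3 := arccos_inner_mem h
      exact (Real.sin_pos_of_pos_of_lt_pi (lt_of_le_of_ne h3.1 (Ne.symm hne))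
        (by linarith [h3.2, Real.pi_pos])).ne' h0
    rw [h2, hf.zero, Real.sin_zero]
  have h2 : ‖contract f η w‖ ^ 2 = 1 := by
    rw [contract_eq hη hw h, norm_add_sq_real, real_inner_smul_left, real_inner_smul_right,
      real_inner_comm (projPerp η w) η, inner_projPerp hη, norm_smul, norm_smul, hη, mul_pow,
      mul_pow,
      Real.norm_eq_abs, Real.norm_eq_abs, sq_abs, sq_abs, ← mul_pow (contractFactor f η w), h1]
    simp [Real.cos_sq_add_sin_sq]
  exact (pow_eq_one_iff_of_nonneg (norm_nonneg _) two_ne_zero).1 h2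

theorem inner_contract_of_orthogonal (hη : ‖η‖ = 1) (hw : ‖w‖ = 1) (h : 0 < ⟪w, η⟫) {e : Euc d}
    (he : ⟪e, η⟫ = 0) : ⟪e, contract f η w⟫ = contractFactor f η w * ⟪e, w⟫ := by
  rw [contract_eq hη hw h, inner_add_right, real_inner_smul_right, real_inner_smul_right, he,
    projPerp, projLine, inner_sub_right, real_inner_smul_right, he]
  ring

theorem inner_reflect_of_orthogonal {e : Euc d} (he : ⟪e, η⟫ = 0) :
    ⟪e, reflect η v⟫ = ⟪e, v⟫ := by
  rw [reflect, inner_sub_right, real_inner_smul_right, he, mul_zero, sub_zero]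

/-- The projection onto the hyperplane orthogonal to `η` as a continuous linear map. -/
noncomputable def projPerpL (η : Euc d) : Euc d →L[ℝ] Euc d :=
  ContinuousLinearMap.id ℝ (Euc d) - (innerSL ℝ η).smulRight η

theorem projPerpL_apply (η w : Euc d) : projPerpL η w = projPerp η w := by
  simp [projPerpL, projPerp, projLine, real_inner_comm]

theorem projPerp_self (hη : ‖η‖ = 1) : projPerp η η = 0 := by
  rw [projPerp, projLine, real_inner_self_eq_norm_sq, hη]
  simp

theorem tendsto_sin_div_sin (hf : IsContractingReflectionLaw f) :
    Filter.Tendsto (fun θ => Real.sin (f θ) / Real.sin θ)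
      (nhdsWithin 0 (Set.Ico 0 (Real.pi / 2) \ {0}))
      (nhds (derivWithin f (Set.Ico 0 (Real.pi / 2)) 0)) := by
  have h0 : (0 : ℝ) ∈ Set.Ico 0 (Real.pi / 2) := ⟨le_rfl, by positivity⟩
  have h1 := (hf.contDiffOn.differentiableOn (by norm_num) 0 h0).hasDerivWithinAt
  have h2 := h1.sin
  rw [hf.zero, Real.cos_zero, one_mul] at h2
  have h3 := (Real.hasDerivAt_sin 0).hasDerivWithinAt (s := Set.Ico 0 (Real.pi / 2))
  rw [hasDerivWithinAt_iff_tendsto_slope] at h2 h3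
  have h4 := h2.div h3 (by simp)
  rw [Real.cos_zero, div_one] at h4
  refine h4.congr' ?_
  filter_upwards [self_mem_nhdsWithin] with θ hθ
  have hne : θ ≠ 0 := hθ.2
  simp only [Pi.div_apply, slope_def_field, hf.zero, Real.sin_zero, sub_zero]
  field_simp

/-- At the pole `η` the law `C_η` is differentiable along the unit sphere only: `arccos` is not
differentiable at `1`. -/
theorem differentiableWithinAt_contract_self (hf : IsContractingReflectionLaw f) (hη : ‖η‖ = 1) :
    DifferentiableWithinAt ℝ (contract f η) {w | ‖w‖ = 1} η := by
  obtain ⟨l, hl0, hl1, hl⟩ := hf.exists_le_mul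
  set S : Set (Euc d) := {w | ‖w‖ = 1} with hS
  have hηη : ⟪η, η⟫ = 1 := by rw [real_inner_self_eq_norm_sq, hη, one_pow]
  have hpos : ∀ᶠ w in nhdsWithin η S, 0 < ⟪w, η⟫ := by
    have h1 : Continuous fun w : Euc d => ⟪w, η⟫ := by fun_prop
    exact nhdsWithin_le_nhds (h1.continuousAt.eventually
      (lt_mem_nhds (hηη ▸ one_pos : (0 : ℝ) < ⟪η, η⟫)))
  -- the normal component is constant to first order
  have hcos : HasFDerivWithinAt (fun w : Euc d => Real.cos (f (Real.arccos ⟪w, η⟫)))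
      (0 : Euc d →L[ℝ] ℝ) S η := by
    refine HasFDerivWithinAt.of_isLittleO ?_
    have hO : (fun w : Euc d => Real.cos (f (Real.arccos ⟪w, η⟫)) -
        Real.cos (f (Real.arccos ⟪η, η⟫)) - (0 : Euc d →L[ℝ] ℝ) (w - η)) =O[nhdsWithin η S]
        fun w => ‖w - η‖ ^ 2 := by
      refine Asymptotics.IsBigO.of_bound ((Real.pi / 2) ^ 2 / 2) ?_
      filter_upwards [hpos, self_mem_nhdsWithin] with w hw hwS
      have hwS : ‖w‖ = 1 := hwS
      have h1 := arccos_inner_mem hw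
      set θ := Real.arccos ⟪w, η⟫ with hθ
      have h2 : f θ ≤ θ := (hl θ h1).trans (by nlinarith [h1.1])
      have h3 := Real.one_sub_sq_div_two_le_cos (x := f θ)
      have h4 : f θ ^ 2 ≤ θ ^ 2 := pow_le_pow_left₀ (hf.mapsTo h1).1 h2 2
      have h5 : θ ≤ Real.pi / 2 * ‖w - η‖ := by
        have h6 := Real.mul_le_sin h1.1 h1.2.le
        have h7 : ‖projPerp η w‖ ≤ ‖w - η‖ := by
          refine (sq_le_sq₀ (norm_nonneg _) (norm_nonneg _)).1 ?_
          rw [norm_projPerp_sq hη, norm_sub_sq_real, hwS, hη]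
          nlinarith [sq_nonneg (⟪w, η⟫ - 1)]
        rw [sin_arccos_inner hη hwS] at h6
        have h8 := h6.trans h7
        calc θ = Real.pi / 2 * (2 / Real.pi * θ) := by field_simp
          _ ≤ _ := by gcongr
      have h9 : θ ^ 2 ≤ (Real.pi / 2) ^ 2 * ‖w - η‖ ^ 2 := by
        rw [← mul_pow]
        exact pow_le_pow_left₀ h1.1 h5 2
      have h10 := Real.cos_le_one (f θ)
      rw [hηη, Real.arccos_one, hf.zero, Real.cos_zero, zero_apply, sub_zero,
        Real.norm_eq_abs, abs_of_nonpos (by linarith), norm_pow, norm_norm]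
      linarith
    refine hO.trans_isLittleO ?_
    have h1 : (fun w : Euc d => ‖w - η‖ ^ 2) =o[nhds η] fun w => w - η := by
      have h2 := (Asymptotics.isLittleO_norm_pow_id (E' := Euc d) one_lt_two)
      have h3 : Filter.Tendsto (fun w : Euc d => w - η) (nhds η) (nhds 0) := by
        have : Continuous fun w : Euc d => w - η := by fun_prop
        simpa using this.tendsto η
      exact h2.comp_tendsto h3
    exact h1.mono nhdsWithin_le_nhds
  -- the tangential component is a linear map times a convergent factor
  have htan : HasFDerivWithinAt (fun w : Euc d => contractFactor f η w • projPerp η w)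
      (derivWithin f (Set.Ico 0 (Real.pi / 2)) 0 • projPerpL η) S η := by
    rw [← hasFDerivWithinAt_sdiff_singleton η]
    have hlim : Filter.Tendsto (fun w : Euc d => contractFactor f η w)
        (nhdsWithin η (S \ {η})) (nhds (derivWithin f (Set.Ico 0 (Real.pi / 2)) 0)) := by
      refine (tendsto_sin_div_sin hf).comp (f := fun w : Euc d => Real.arccos ⟪w, η⟫) ?_
      refine tendsto_nhdsWithin_iff.2 ⟨?_, ?_⟩
      · have h1 : Continuous fun w : Euc d => Real.arccos ⟪w, η⟫ :=
          Real.continuous_arccos.comp (by fun_prop)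
        have h2 := h1.tendsto η
        rw [hηη, Real.arccos_one] at h2
        exact h2.mono_left nhdsWithin_le_nhds
      · filter_upwards [self_mem_nhdsWithin,
          nhdsWithin_mono η Set.sdiff_subset hpos] with w hwS hw
        refine ⟨arccos_inner_mem hw, fun h0 => hwS.2 ?_⟩
        have h1 : 1 ≤ ⟪w, η⟫ := Real.arccos_eq_zero.1 h0
        exact (inner_eq_one_iff_of_norm_eq_one hwS.1 hη).1
          (le_antisymm (inner_le_one hη hwS.1) h1)
    refine HasFDerivWithinAt.of_isLittleO ?_
    have h1 : (fun w : Euc d => contractFactor f η w -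
        derivWithin f (Set.Ico 0 (Real.pi / 2)) 0) =o[nhdsWithin η (S \ {η})]
        fun _ => (1 : ℝ) := by
      rw [Asymptotics.isLittleO_one_iff]
      simpa using hlim.sub_const (derivWithin f (Set.Ico 0 (Real.pi / 2)) 0)
    have h2 : (fun w : Euc d => projPerpL η (w - η)) =O[nhdsWithin η (S \ {η})]
        fun w => w - η := (projPerpL η).isBigO_sub _ _
    refine (h1.smul_isBigO h2).congr (fun w => ?_) (fun w => one_smul _ _)
    rw [projPerp_self hη, smul_zero, sub_zero, smul_apply, map_sub,
      projPerpL_apply, projPerpL_apply, projPerp_self hη, sub_zero, sub_smul]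
  have hsum := (hcos.smul_const η).add htan
  refine hsum.differentiableWithinAt.congr_of_eventuallyEq ?_
    (contract_eq hη hη (by rw [hηη]; exact one_pos))
  filter_upwards [hpos, self_mem_nhdsWithin] with w hw hwS
  exact contract_eq hη hwS hw

theorem differentiableWithinAt_contract (hf : IsContractingReflectionLaw f) (hη : ‖η‖ = 1)
    (hw : ‖w‖ = 1) (h : 0 < ⟪w, η⟫) :
    DifferentiableWithinAt ℝ (contract f η) {w | ‖w‖ = 1} w := by
  rcases (inner_le_one hη hw).eq_or_lt with h1 | h1
  · rw [(inner_eq_one_iff_of_norm_eq_one hw hη).1 h1]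
    exact differentiableWithinAt_contract_self hf hη
  · refine DifferentiableAt.differentiableWithinAt ?_
    have hθ := arccos_inner_mem h
    have hθ0 : 0 < Real.arccos ⟪w, η⟫ := Real.arccos_pos.2 h1
    have hsin : Real.sin (Real.arccos ⟪w, η⟫) ≠ 0 :=
      (Real.sin_pos_of_pos_of_lt_pi hθ0 (by linarith [hθ.2, Real.pi_pos])).ne'
    have hcos : Real.cos (Real.arccos ⟪w, η⟫) ≠ 0 := by
      rw [cos_arccos_inner hη hw h]; exact h.ne'
    have hfd : DifferentiableAt ℝ f (Real.arccos ⟪w, η⟫) :=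
      (hf.contDiffOn.differentiableOn (by norm_num) _ hθ).differentiableAt
        (Ico_mem_nhds hθ0 hθ.2)
    have hin : DifferentiableAt ℝ (fun w : Euc d => ⟪w, η⟫) w :=
      differentiableAt_id.inner ℝ (differentiableAt_const η)
    have hacos : DifferentiableAt ℝ (fun w : Euc d => Real.arccos ⟪w, η⟫) w :=
      DifferentiableAt.fun_comp' (g := Real.arccos) (f := fun w : Euc d => ⟪w, η⟫) w
        (Real.differentiableAt_arccos.2 ⟨by linarith, h1.ne⟩) hin
    have hfa : DifferentiableAt ℝ (fun w : Euc d => f (Real.arccos ⟪w, η⟫)) w :=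
      DifferentiableAt.fun_comp' (g := f) (f := fun w : Euc d => Real.arccos ⟪w, η⟫) w hfd hacos
    have hA : DifferentiableAt ℝ (fun w : Euc d =>
        Real.cos (f (Real.arccos ⟪w, η⟫)) / Real.cos (Real.arccos ⟪w, η⟫)) w := by
      simpa only [div_eq_mul_inv] using hfa.cos.fun_mul (hacos.cos.fun_inv hcos)
    have hB : DifferentiableAt ℝ (fun w : Euc d =>
        Real.sin (f (Real.arccos ⟪w, η⟫)) / Real.sin (Real.arccos ⟪w, η⟫)) w := by
      simpa only [div_eq_mul_inv] using hfa.sin.fun_mul (hacos.sin.fun_inv hsin)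
    have hL : DifferentiableAt ℝ (fun w : Euc d => ⟪w, η⟫ • η) w := hin.smul_const η
    exact (hA.fun_smul hL).fun_add (hB.fun_smul (differentiableAt_id.fun_sub hL))

end laws

/-! ### The billiard map near a regular point -/

section billiard

variable {d : ℕ} {P : Set (Euc d)} {f : ℝ → ℝ} {η : Euc d} {x : Euc d × Euc d}

/-- The time at which the line through `z.1` with velocity `z.2` crosses the hyperplane
`{y | ⟪y, η⟫ = c}`. -/
noncomputable def crossingTime (η : Euc d) (c : ℝ) (z : Euc d × Euc d) : ℝ :=
  (c - ⟪z.1, η⟫) / ⟪z.2, η⟫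

theorem inner_crossing (c : ℝ) (h : ⟪x.2, η⟫ ≠ 0) :
    ⟪x.1 + crossingTime η c x • x.2, η⟫ = c := by
  rw [inner_add_left, real_inner_smul_left, crossingTime, div_mul_cancel₀ _ h]
  ring

theorem crossingTime_eq {t c : ℝ} (h : ⟪x.2, η⟫ ≠ 0) (hc : ⟪x.1 + t • x.2, η⟫ = c) :
    crossingTime η c x = t := by
  rw [crossingTime, ← hc, inner_add_left, real_inner_smul_left, add_sub_cancel_left,
    mul_div_cancel_right₀ _ h]

theorem differentiableAt_crossingTime (c : ℝ) (h : ⟪x.2, η⟫ ≠ 0) :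
    DifferentiableAt ℝ (crossingTime η c) x := by
  have h1 : DifferentiableAt ℝ (fun z : Euc d × Euc d => ⟪z.1, η⟫) x :=
    differentiableAt_fst.inner ℝ (differentiableAt_const η)
  have h2 : DifferentiableAt ℝ (fun z : Euc d × Euc d => ⟪z.2, η⟫) x :=
    differentiableAt_snd.inner ℝ (differentiableAt_const η)
  change DifferentiableAt ℝ (fun z : Euc d × Euc d => (c - ⟪z.1, η⟫) / ⟪z.2, η⟫) x
  simpa only [div_eq_mul_inv] using ((differentiableAt_const c).fun_sub h1).fun_mul (h2.fun_inv h)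

theorem billiardMap_eq (hd : 2 ≤ d) (hP : IsFullPolytope P) (hη : η ∈ normals P)
    (hq : x.1 + flightTime P x • x.2 ∈ faceInterior P η) :
    billiardMap f P x =
      (x.1 + flightTime P x • x.2, contract f η (reflect η x.2)) := by
  simp only [billiardMap, specularMap, normalAt_eq hd hP hη hq]

theorem norm_snd_of_mem_phase (hx : x ∈ phase P) : ‖x.2‖ = 1 := by
  obtain ⟨-, -, -, h, -⟩ := hx
  exact h

theorem collision_mem_phase (hf : IsContractingReflectionLaw f) (hx : x ∈ phase P)
    (hη : η ∈ normals P) {q : Euc d} (hq : q ∈ faceInterior P η) (hv : ⟪x.2, η⟫ < 0) :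
    (q, contract f η (reflect η x.2)) ∈ phase P := by
  have h1 : ‖reflect η x.2‖ = 1 := (norm_reflect hη.1 _).trans (norm_snd_of_mem_phase hx)
  have h2 : 0 < ⟪reflect η x.2, η⟫ := by rw [inner_reflect hη.1]; linarith
  exact ⟨η, hη, hq, norm_contract hf hη.1 h1 h2, inner_contract_pos hf hη.1 h1 h2⟩

/-- All points of the phase space near a regular point collide with the same face. -/
theorem eventually_collision (hd : 2 ≤ d) (hP : IsFullPolytope P) (hx : x ∈ phase P)
    (hη : η ∈ normals P) (ht : 0 < flightTime P x)
    (hq : x.1 + flightTime P x • x.2 ∈ faceInterior P η) :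
    ∀ᶠ z in nhdsWithin x (phase P), ⟪z.2, η⟫ < 0 ∧
      flightTime P z = crossingTime η ⟪x.1 + flightTime P x • x.2, η⟫ z ∧
      z.1 + flightTime P z • z.2 ∈ faceInterior P η := by
  set c := ⟪x.1 + flightTime P x • x.2, η⟫ with hc
  obtain ⟨hqF, r, hr, hball⟩ := (mem_faceInterior_iff hη).1 hq
  have hv := inner_neg_of_mem_face hd hP hx hη ht hqF
  have hct : crossingTime η c x = flightTime P x := crossingTime_eq hv.ne rfl
  have hcont := (differentiableAt_crossingTime (x := x) (η := η) c hv.ne).continuousAt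
  have h1 : ∀ᶠ z in nhds x, 0 < crossingTime η c z :=
    hcont.eventually (lt_mem_nhds (hct ▸ ht))
  have h2 : ∀ᶠ z : Euc d × Euc d in nhds x, ⟪z.2, η⟫ < 0 := by
    have : Continuous fun z : Euc d × Euc d => ⟪z.2, η⟫ := by fun_prop
    exact this.continuousAt.eventually (gt_mem_nhds hv)
  have h3 : ∀ᶠ z : Euc d × Euc d in nhds x,
      dist (z.1 + crossingTime η c z • z.2) (x.1 + flightTime P x • x.2) < r / 2 := by
    have h4 : ContinuousAt (fun z : Euc d × Euc d => z.1 + crossingTime η c z • z.2) x :=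
      continuousAt_fst.add (hcont.smul continuousAt_snd)
    have h5 := h4.eventually (Metric.ball_mem_nhds _ (half_pos hr))
    simp only [hct] at h5
    exact h5
  filter_upwards [nhdsWithin_le_nhds h1, nhdsWithin_le_nhds h2, nhdsWithin_le_nhds h3,
    self_mem_nhdsWithin] with z hz1 hz2 hz3 hz
  have hi : ⟪z.1 + crossingTime η c z • z.2, η⟫ = c := inner_crossing c hz2.ne
  have hF : z.1 + crossingTime η c z • z.2 ∈ face P η := hball _ (by linarith) hi
  have hfl : flightTime P z = crossingTime η c z := flightTime_eq hd hP hz hη hz1 hF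
  refine ⟨hz2, hfl, ?_⟩
  rw [hfl]
  refine (mem_faceInterior_iff hη).2 ⟨hF, r / 2, half_pos hr, fun y hy hyi => ?_⟩
  refine hball y ?_ (hyi.trans hi)
  have := dist_triangle y (z.1 + crossingTime η c z • z.2) (x.1 + flightTime P x • x.2)
  linarith

/-- The billiard map is differentiable along the phase space at regular points, and maps a
neighbourhood into the phase space. -/
theorem differentiableWithinAt_billiardMap (hd : 2 ≤ d) (hP : IsFullPolytope P)
    (hf : IsContractingReflectionLaw f) (hx : x ∈ regular P) :
    DifferentiableWithinAt ℝ (billiardMap f P) (phase P) x ∧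
      ∀ᶠ z in nhdsWithin x (phase P), billiardMap f P z ∈ phase P := by
  obtain ⟨ht, η, hη, hq, hv⟩ := exists_collision hd hP hx
  have hev := eventually_collision hd hP hx.1 hη ht hq
  set c := ⟪x.1 + flightTime P x • x.2, η⟫ with hc
  constructor
  · have h1 : DifferentiableWithinAt ℝ (fun z : Euc d × Euc d =>
        z.1 + crossingTime η c z • z.2) (phase P) x :=
      (differentiableAt_fst.fun_add ((differentiableAt_crossingTime c hv.ne).fun_smul
        differentiableAt_snd)).differentiableWithinAt
    have h2 : DifferentiableWithinAt ℝ (fun z : Euc d × Euc d =>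
        contract f η (reflect η z.2)) (phase P) x := by
      have h3 : DifferentiableAt ℝ (fun z : Euc d × Euc d => reflect η z.2) x := by
        have h4 : DifferentiableAt ℝ (fun z : Euc d × Euc d => 2 * ⟪z.2, η⟫) x :=
          (differentiableAt_const 2).fun_mul
            (differentiableAt_snd.inner ℝ (differentiableAt_const η))
        exact differentiableAt_snd.fun_sub (h4.smul_const η)
      refine DifferentiableWithinAt.comp (g := contract f η) x (t := {w | ‖w‖ = 1})
        (differentiableWithinAt_contract hf hη.1 ?_ ?_) h3.differentiableWithinAt ?_
      · exact (norm_reflect hη.1 _).trans (norm_snd_of_mem_phase hx.1)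
      · rw [inner_reflect hη.1]; linarith
      · intro z hz
        exact (norm_reflect hη.1 _).trans (norm_snd_of_mem_phase hz)
    have h3 : (billiardMap f P) =ᶠ[nhdsWithin x (phase P)] fun z =>
        (z.1 + crossingTime η c z • z.2, contract f η (reflect η z.2)) := by
      filter_upwards [hev] with z hz
      rw [billiardMap_eq hd hP hη hz.2.2, hz.2.1]
    exact (h1.prodMk h2).congr_of_eventuallyEq h3 (h3.self_of_nhdsWithin hx.1)
  · filter_upwards [hev, self_mem_nhdsWithin] with z hz hzp
    rw [billiardMap_eq hd hP hη hz.2.2]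
    exact collision_mem_phase hf hzp hη hz.2.2 hz.1

theorem differentiableWithinAt_iterate (hd : 2 ≤ d) (hP : IsFullPolytope P)
    (hf : IsContractingReflectionLaw f) (hx : x ∈ forward f P) (n : ℕ) :
    DifferentiableWithinAt ℝ (billiardMap f P)^[n] (phase P) x ∧
      ∀ᶠ z in nhdsWithin x (phase P), (billiardMap f P)^[n] z ∈ phase P := by
  induction n with
  | zero => exact ⟨differentiableWithinAt_id, self_mem_nhdsWithin⟩
  | succ n ih =>
    obtain ⟨h1, h2⟩ := ih
    obtain ⟨h3, h4⟩ := differentiableWithinAt_billiardMap hd hP hf (hx.2 n)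
    rw [Function.iterate_succ']
    refine ⟨?_, ?_⟩
    · exact (differentiableWithinAt_inter' h2).1 (h3.comp' x h1)
    · have h5 : Filter.Tendsto (billiardMap f P)^[n] (nhdsWithin x (phase P))
          (nhdsWithin ((billiardMap f P)^[n] x) (phase P)) :=
        tendsto_nhdsWithin_iff.2 ⟨h1.continuousWithinAt, h2⟩
      exact h5.eventually h4

/-! ### The action on the unstable spaces -/

theorem normalAt_spec (hd : 2 ≤ d) (hP : IsFullPolytope P) (hx : x ∈ phase P) :
    normalAt P x.1 ∈ normals P ∧ x.1 ∈ faceInterior P (normalAt P x.1) ∧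
      0 < ⟪x.2, normalAt P x.1⟫ := by
  obtain ⟨η, hη, hp, -, hv⟩ := hx
  rw [normalAt_eq hd hP hη hp]
  exact ⟨hη, hp, hv⟩

theorem eventually_mem_phase (hd : 2 ≤ d) (hP : IsFullPolytope P) (hx : x ∈ phase P) {u : Euc d}
    (hu : ⟪u, normalAt P x.1⟫ = 0) : ∀ᶠ t : ℝ in nhds 0, (x.1 + t • u, x.2) ∈ phase P := by
  obtain ⟨hη, hp, hv⟩ := normalAt_spec hd hP hx
  obtain ⟨hpF, r, hr, hball⟩ := (mem_faceInterior_iff hη).1 hp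
  have h1 : Continuous fun t : ℝ => dist (x.1 + t • u) x.1 := by fun_prop
  filter_upwards [h1.continuousAt.eventually (gt_mem_nhds
    (by simpa using half_pos hr : dist (x.1 + (0 : ℝ) • u) x.1 < r / 2))] with t ht
  have hi : ⟪x.1 + t • u, normalAt P x.1⟫ = ⟪x.1, normalAt P x.1⟫ := by
    rw [inner_add_left, real_inner_smul_left, hu, mul_zero, add_zero]
  have hv1 := norm_snd_of_mem_phase hx
  refine ⟨_, hη, (mem_faceInterior_iff hη).2 ⟨hball _ (by linarith) hi, r / 2, half_pos hr,
    fun y hy hyi => hball y ?_ (hyi.trans hi)⟩, hv1, hv⟩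
  have := dist_triangle y (x.1 + t • u) x.1
  linarith

/-- The coefficient of the velocity in the projection of `u` along the velocity of `x` to the
hyperplane of the next face. -/
noncomputable def shiftCoeff (f : ℝ → ℝ) (P : Set (Euc d)) (x : Euc d × Euc d) (u : Euc d) : ℝ :=
  -⟪u, normalAt P (billiardMap f P x).1⟫ / ⟪x.2, normalAt P (billiardMap f P x).1⟫

/-- What a collision does: the new velocity, the change of normal components, and the displacement
of the collision point when the initial point moves along its face with fixed velocity. -/
theorem collision_step (hd : 2 ≤ d) (hP : IsFullPolytope P) (hx : x ∈ regular P) :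
    ⟪x.2, normalAt P (billiardMap f P x).1⟫ < 0 ∧
    (billiardMap f P x).2 = contract f (normalAt P (billiardMap f P x).1)
      (reflect (normalAt P (billiardMap f P x).1) x.2) ∧
    ∀ u : Euc d, ⟪u, normalAt P x.1⟫ = 0 → ∀ᶠ t : ℝ in nhds 0,
      billiardMap f P (x.1 + t • u, x.2) =
        ((billiardMap f P x).1 + t • (u + shiftCoeff f P x u • x.2), (billiardMap f P x).2) := by
  obtain ⟨ht, η, hη, hq, hv⟩ := exists_collision hd hP hx
  have hev := eventually_collision hd hP hx.1 hη ht hq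
  have hb := billiardMap_eq (f := f) hd hP hη hq
  have hn : normalAt P (billiardMap f P x).1 = η := by
    rw [hb]
    exact normalAt_eq hd hP hη hq
  have hct : crossingTime η ⟪x.1 + flightTime P x • x.2, η⟫ x = flightTime P x :=
    crossingTime_eq hv.ne rfl
  refine ⟨by rw [hn]; exact hv, by rw [hn, hb], fun u hu => ?_⟩
  rw [shiftCoeff, hn, hb]
  have hcurve : Filter.Tendsto (fun t : ℝ => (x.1 + t • u, x.2)) (nhds 0)
      (nhdsWithin x (phase P)) := by
    refine tendsto_nhdsWithin_iff.2 ⟨?_, eventually_mem_phase hd hP hx.1 hu⟩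
    have : Continuous fun t : ℝ => (x.1 + t • u, x.2) := by fun_prop
    simpa using this.tendsto 0
  filter_upwards [hcurve.eventually hev] with t htc
  rw [billiardMap_eq hd hP hη htc.2.2, htc.2.1]
  refine Prod.ext ?_ rfl
  have h1 : crossingTime η ⟪x.1 + flightTime P x • x.2, η⟫ (x.1 + t • u, x.2) =
      flightTime P x + t * (-⟪u, η⟫ / ⟪x.2, η⟫) := by
    have hne := hv.ne
    simp only [crossingTime, inner_add_left, real_inner_smul_left]
    field_simp
    ring
  simp only [h1]
  module

/-- The base-point components of the images of the unstable vector `(u, 0)`. -/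
noncomputable def unstableOrbit (f : ℝ → ℝ) (P : Set (Euc d)) (x : Euc d × Euc d) (u : Euc d) :
    ℕ → Euc d
  | 0 => u
  | n + 1 => unstableOrbit f P x u n +
      shiftCoeff f P ((billiardMap f P)^[n] x) (unstableOrbit f P x u n) •
        ((billiardMap f P)^[n] x).2

theorem inner_unstableOrbit (hd : 2 ≤ d) (hP : IsFullPolytope P) (hx : x ∈ forward f P)
    {u : Euc d} (hu : ⟪u, normalAt P x.1⟫ = 0) (n : ℕ) :
    ⟪unstableOrbit f P x u n, normalAt P ((billiardMap f P)^[n] x).1⟫ = 0 := by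
  cases n with
  | zero => exact hu
  | succ n =>
    have h1 := (collision_step (f := f) hd hP (hx.2 n)).1
    rw [Function.iterate_succ_apply', unstableOrbit, inner_add_left, real_inner_smul_left,
      shiftCoeff, div_mul_cancel₀ _ h1.ne, add_neg_cancel]

/-- With the velocity kept fixed, the iterates are locally affine in the base point. -/
theorem eventually_iterate_eq (hd : 2 ≤ d) (hP : IsFullPolytope P) (hx : x ∈ forward f P)
    {u : Euc d} (hu : ⟪u, normalAt P x.1⟫ = 0) (n : ℕ) :
    ∀ᶠ t : ℝ in nhds 0, (billiardMap f P)^[n] (x.1 + t • u, x.2) =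
      (((billiardMap f P)^[n] x).1 + t • unstableOrbit f P x u n, ((billiardMap f P)^[n] x).2) := by
  induction n with
  | zero => exact Filter.Eventually.of_forall fun t => rfl
  | succ n ih =>
    have h1 := (collision_step (f := f) hd hP (hx.2 n)).2.2 _
      (inner_unstableOrbit hd hP hx hu n)
    filter_upwards [ih, h1] with t ht1 ht2
    rw [Function.iterate_succ_apply', Function.iterate_succ_apply', ht1, ht2, unstableOrbit]

/-- Any derivative of an iterate along the phase space has the expected values on the unstable
space: it is determined there by the curves with fixed velocity. -/
theorem hasFDerivWithinAt_iterate_apply (hd : 2 ≤ d) (hP : IsFullPolytope P) (hx : x ∈ forward f P)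
    {u : Euc d} (hu : ⟪u, normalAt P x.1⟫ = 0) {n : ℕ}
    {A : (Euc d × Euc d) →L[ℝ] (Euc d × Euc d)}
    (hA : HasFDerivWithinAt (billiardMap f P)^[n] A (phase P) x) :
    A (u, 0) = (unstableOrbit f P x u n, 0) := by
  have hline : ∀ (p v w : Euc d), HasDerivAt (fun t : ℝ => (p + t • w, v)) (w, 0) 0 := by
    intro p v w
    have h1 : HasDerivAt (fun t : ℝ => p + t • w) w 0 := by
      simpa using ((hasDerivAt_id (0 : ℝ)).smul_const w).const_add p
    exact h1.prodMk (hasDerivAt_const _ _)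
  set γ : ℝ → Euc d × Euc d := fun t => (x.1 + t • u, x.2) with hγ
  have hγ0 : γ 0 = x := by simp [hγ]
  have hmem : γ ⁻¹' phase P ∈ nhds (0 : ℝ) := eventually_mem_phase hd hP hx.1 hu
  have h1 : HasDerivWithinAt ((billiardMap f P)^[n] ∘ γ) (A (u, 0)) (γ ⁻¹' phase P) 0 := by
    refine HasFDerivWithinAt.comp_hasDerivWithinAt (t := phase P) 0 ?_
      (hline x.1 x.2 u).hasDerivWithinAt fun t ht => ht
    change HasFDerivWithinAt _ _ _ (γ 0)
    rw [hγ0]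
    exact hA
  have h2 := h1.hasDerivAt hmem
  have h3 := (hline _ _ _).congr_of_eventuallyEq (eventually_iterate_eq hd hP hx hu n)
  exact h2.unique h3

/-- The images of an unstable vector form an orbit of the linearised dynamics. -/
theorem isUnstableOrbit (hd : 2 ≤ d) (hP : IsFullPolytope P) (hf : IsContractingReflectionLaw f)
    {ρ : ℝ} (hρ0 : 0 ≤ ρ)
    (hρ : ∀ θ ∈ Set.Ico 0 (Real.pi / 2), Real.sin (f θ) ≤ ρ * Real.sin θ)
    (hx : x ∈ forward f P) {u : Euc d} (hu : ⟪u, normalAt P x.1⟫ = 0) :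
    IsUnstableOrbit ρ (fun n => normalAt P ((billiardMap f P)^[n] x).1)
      (fun n => ((billiardMap f P)^[n] x).2) (unstableOrbit f P x u)
      (fun n => contractFactor f (normalAt P ((billiardMap f P)^[n + 1] x).1)
        (reflect (normalAt P ((billiardMap f P)^[n + 1] x).1) ((billiardMap f P)^[n] x).2))
      (fun n => shiftCoeff f P ((billiardMap f P)^[n] x) (unstableOrbit f P x u n)) := by
  have hunit : ∀ n, ‖normalAt P ((billiardMap f P)^[n] x).1‖ = 1 := fun n =>
    (normalAt_spec hd hP (hx.2 n).1).1.1
  have hpos : ∀ n, 0 < ⟪reflect (normalAt P ((billiardMap f P)^[n + 1] x).1)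
      ((billiardMap f P)^[n] x).2, normalAt P ((billiardMap f P)^[n + 1] x).1⟫ := by
    intro n
    have h1 := (collision_step (f := f) hd hP (hx.2 n)).1
    rw [← Function.iterate_succ_apply' (billiardMap f P)] at h1
    rw [inner_reflect (hunit (n + 1))]
    linarith
  refine ⟨fun n => norm_snd_of_mem_phase (hx.2 n).1, inner_unstableOrbit hd hP hx hu,
    fun n => rfl, fun n => contractFactor_nonneg hf (hpos n),
    fun n => contractFactor_le hρ0 hρ (hpos n), fun n e he => ?_⟩
  have h2 := (collision_step (f := f) hd hP (hx.2 n)).2.1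
  rw [← Function.iterate_succ_apply' (billiardMap f P)] at h2
  have he : ⟪e, normalAt P ((billiardMap f P)^[n + 1] x).1⟫ = 0 := he
  change ⟪e, ((billiardMap f P)^[n + 1] x).2⟫ = _
  rw [h2, inner_contract_of_orthogonal (hunit (n + 1))
    ((norm_reflect (hunit (n + 1)) _).trans (norm_snd_of_mem_phase (hx.2 n).1)) (hpos n) he,
    inner_reflect_of_orthogonal he]

theorem mem_unstable_iff {ξ : Euc d × Euc d} :
    ξ ∈ unstable P x ↔ ⟪ξ.1, normalAt P x.1⟫ = 0 ∧ ξ.2 = 0 := by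
  simp only [unstable, tangentM, Submodule.mem_inf, Submodule.mem_prod,
    Submodule.mem_orthogonal_singleton_iff_inner_left, LinearMap.mem_ker]
  constructor
  · rintro ⟨⟨h1, -⟩, h3⟩
    exact ⟨h1, h3⟩
  · rintro ⟨h1, h2⟩
    exact ⟨⟨h1, by rw [h2, inner_zero_left]⟩, h2⟩

theorem finrank_unstable (hd : 2 ≤ d) (hP : IsFullPolytope P) (hx : x ∈ phase P) :
    Module.finrank ℝ (unstable P x) + 1 = d := by
  have h1 : unstable P x =
      (ℝ ∙ normalAt P x.1)ᗮ.map (LinearMap.inl ℝ (Euc d) (Euc d)) := by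
    ext ξ
    rw [mem_unstable_iff, Submodule.mem_map]
    constructor
    · rintro ⟨h1, h2⟩
      exact ⟨ξ.1, Submodule.mem_orthogonal_singleton_iff_inner_left.2 h1, Prod.ext rfl h2.symm⟩
    · rintro ⟨u, hu, rfl⟩
      exact ⟨Submodule.mem_orthogonal_singleton_iff_inner_left.1 hu, rfl⟩
  rw [h1, ← (Submodule.equivMapOfInjective _ LinearMap.inl_injective _).finrank_eq]
  exact finrank_orthogonal_add_one
    (ne_zero_of_mem_normals (normalAt_spec hd hP hx).1)

theorem jacobiNorm_eq (hx : x ∈ phase P) {ξ : Euc d × Euc d} (hξ : ξ.2 = 0) :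
    jacobiNorm x ξ = √(‖ξ.1‖ ^ 2 - ⟪ξ.1, x.2⟫ ^ 2) := by
  have h1 : (jacobi x ξ).1 = projPerp x.2 ξ.1 := rfl
  have h2 : (jacobi x ξ).2 = ξ.2 := rfl
  rw [jacobiNorm, h1, h2, hξ, norm_zero, norm_projPerp_sq (norm_snd_of_mem_phase hx)]
  simp

theorem eq_zero_of_jacobiNorm_eq_zero (hd : 2 ≤ d) (hP : IsFullPolytope P) (hx : x ∈ phase P)
    {u : Euc d} (hu : ⟪u, normalAt P x.1⟫ = 0) (h : ‖u‖ ^ 2 - ⟪u, x.2⟫ ^ 2 ≤ 0) : u = 0 := by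
  have hv := (normalAt_spec hd hP hx).2.2
  rw [← norm_projPerp_sq (norm_snd_of_mem_phase hx)] at h
  have h1 : projPerp x.2 u = 0 :=
    norm_eq_zero.1 (pow_eq_zero_iff two_ne_zero |>.1 (le_antisymm h (sq_nonneg _)))
  have h2 : u = ⟪u, x.2⟫ • x.2 := sub_eq_zero.1 h1
  rw [h2, real_inner_smul_left] at hu
  rw [h2, (mul_eq_zero.1 hu).resolve_right hv.ne', zero_smul]

end billiard

end PolytopeBilliard

theorem theorem2p9 {d : ℕ} (hd : 2 ≤ d) (P : Set (PolytopeBilliard.Euc d))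
    (hP : PolytopeBilliard.IsFullPolytope P) (hspan : PolytopeBilliard.IsSpanning P)
    (f : ℝ → ℝ) (hf : PolytopeBilliard.IsContractingReflectionLaw f) :
    ∃ σ : ℝ, 1 < σ ∧ ∀ k : ℕ, d ≤ k → ∀ x ∈ PolytopeBilliard.domainD f P,
      PolytopeBilliard.IsGenerating f P k x →
        PolytopeBilliard.InverseBoundOnUnstable f P (2 * k) x (1 / σ) := by
  open PolytopeBilliard in
  obtain ⟨ρ', hρ'1, hρ'⟩ := hf.exists_sin_le
  -- enlarge the constant to make it nonnegative
  obtain ⟨ρ, hρ0, hρ1, hρ⟩ : ∃ ρ : ℝ, 0 ≤ ρ ∧ ρ < 1 ∧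
      ∀ θ ∈ Set.Ico 0 (Real.pi / 2), Real.sin (f θ) ≤ ρ * Real.sin θ := by
    refine ⟨max ρ' 0, le_max_right _ _, max_lt hρ'1 one_pos, fun θ hθ => (hρ' θ hθ).trans ?_⟩
    exact mul_le_mul_of_nonneg_right (le_max_left _ _)
      (Real.sin_nonneg_of_nonneg_of_le_pi hθ.1 (by linarith [hθ.2, Real.pi_pos]))
  obtain ⟨κ, hκ, hgap⟩ := exists_uniform_gap (finite_normals hd hP)
  set C := IsUnstableOrbit.spanConst κ ρ d with hCdef
  have hC : 0 < C := IsUnstableOrbit.spanConst_pos hκ hρ1 d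
  set m : ℝ := 1 + (1 - ρ ^ 2) / C ^ 2 with hm
  have hm1 : 1 < m := by
    have : 0 < 1 - ρ ^ 2 := by nlinarith
    have : 0 < (1 - ρ ^ 2) / C ^ 2 := by positivity
    linarith
  have hm0 : 0 < m := by linarith
  refine ⟨√m, by rw [Real.lt_sqrt zero_le_one]; simpa using hm1, fun k hk x _ hx => ?_⟩
  obtain ⟨hxf, hgen⟩ := hx
  refine ⟨(differentiableWithinAt_iterate hd hP hf hxf _).1, fun A hA => ?_⟩
  have hnorm : ∀ n, normalAt P ((billiardMap f P)^[n] x).1 ∈ normals P := fun n =>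
    (normalAt_spec hd hP (hxf.2 n).1).1
  -- growth of the Jacobi norm along the orbit of an unstable vector
  have hgrow : ∀ u : Euc d, ⟪u, normalAt P x.1⟫ = 0 →
      m * (‖u‖ ^ 2 - ⟪u, x.2⟫ ^ 2) ≤ ‖unstableOrbit f P x u (2 * k)‖ ^ 2 -
        ⟪unstableOrbit f P x u (2 * k), ((billiardMap f P)^[2 * k] x).2⟫ ^ 2 := by
    intro u hu
    have horb := isUnstableOrbit hd hP hf hρ0 hρ hxf hu
    have h1 := horb.energy_growth hρ1 hκ (fun n => (hnorm n).1)
      (fun A n hn => hgap _ (by rintro _ ⟨i, -, rfl⟩; exact hnorm i) _ (hnorm n) hn)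
      -- the window starts at time `1`: the first flight need not be a short displacement of `u`
      (hgen 1 (k + 1) (by omega))
    rw [finrank_euclideanSpace_fin] at h1
    exact h1.trans (horb.energy_mono hρ1 (by omega))
  have hxp := hxf.1
  have hyp := (hxf.2 (2 * k)).1
  have hAapp : ∀ ξ ∈ unstable P x, A ξ = (unstableOrbit f P x ξ.1 (2 * k), 0) := by
    intro ξ hξ
    obtain ⟨h1, h2⟩ := mem_unstable_iff.1 hξ
    rw [← hasFDerivWithinAt_iterate_apply hd hP hxf h1 hA, ← h2]
  have hmaps : ∀ ξ ∈ unstable P x,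
      (A : (Euc d × Euc d) →ₗ[ℝ] (Euc d × Euc d)) ξ ∈
        unstable P ((billiardMap f P)^[2 * k] x) := by
    intro ξ hξ
    rw [ContinuousLinearMap.coe_coe, hAapp ξ hξ]
    exact mem_unstable_iff.2
      ⟨inner_unstableOrbit hd hP hxf (mem_unstable_iff.1 hξ).1 _, rfl⟩
  set L₀ := (A : (Euc d × Euc d) →ₗ[ℝ] (Euc d × Euc d)).restrict hmaps with hL₀
  have hinj : Function.Injective L₀ := by
    rw [← LinearMap.ker_eq_bot, LinearMap.ker_eq_bot']
    rintro ⟨ξ, hξ⟩ h0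
    have h1 : A ξ = 0 := congrArg Subtype.val h0
    rw [hAapp ξ hξ] at h1
    have h2 : unstableOrbit f P x ξ.1 (2 * k) = 0 := congrArg Prod.fst h1
    obtain ⟨h3, h4⟩ := mem_unstable_iff.1 hξ
    have h5 := hgrow ξ.1 h3
    rw [h2, norm_zero, inner_zero_left] at h5
    have h6 : ξ.1 = 0 := eq_zero_of_jacobiNorm_eq_zero hd hP hxp h3 (by
      by_contra! hcon
      have := mul_pos hm0 hcon
      norm_num at h5
      linarith)
    exact Subtype.ext (Prod.ext h6 h4)
  have hrank : Module.finrank ℝ (unstable P x) =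
      Module.finrank ℝ (unstable P ((billiardMap f P)^[2 * k] x)) := by
    have h1 := finrank_unstable hd hP hxp
    have h2 := finrank_unstable hd hP hyp
    omega
  set L := L₀.linearEquivOfInjective hinj hrank with hL
  have hLA : ∀ ξ : unstable P x, (L ξ : Euc d × Euc d) = A ξ := fun ξ => rfl
  refine ⟨L, hLA, fun ζ => ?_⟩
  obtain ⟨ξ, rfl⟩ := L.surjective ζ
  rw [L.symm_apply_apply, hLA, hAapp _ ξ.2, jacobiNorm_eq hxp (mem_unstable_iff.1 ξ.2).2,
    jacobiNorm_eq hyp rfl, one_div, ← div_eq_inv_mul, le_div_iff₀ (Real.sqrt_pos.2 hm0),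
    ← Real.sqrt_mul' _ hm0.le, mul_comm]
  exact Real.sqrt_le_sqrt (hgrow _ (mem_unstable_iff.1 ξ.2).1)
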